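/- Let $\mathcal R$ be Riemann's auxiliary function, the entire function \[ \mathcal R(s)=\int_{0\swarrow 1}\frac{x^{-s}e^{\pi i x^2}}{e^{\pi i x}-e^{-\pi i x}}\,dx , \] where the integral is taken along a straight line of direction $e^{\pi i/4}$ that crosses the real axis at a point strictly between $0$ and $1$ (for example at $1/2$), traversed from the upper right to the lower left, and $x^{-s}=e^{-s\log x}$ with the principal branch of the logarithm. Write $s=\sigma+it$ with $\sigma,t$ real. Then \[ \Bigl|\mathcal R(s)-\sum_{1\le n\le\sqrt{t/2\pi}}\frac1{n^s}\Bigr|\le\Bigl(\frac t{2\pi}\Bigr)^{-\sigma/2}\qquad\text{for } 0\le\sigma\le1,\ t\ge3\pi, \] and \[ \Bigl|\mathcal R(s)-\sum_{1\le n\le\sqrt{t/2\pi}}\frac1{n^s}\Bigr|\le\Bigl(\frac t{2\pi}\Bigr)^{-1/2}\qquad\text{for } \sigma\ge1,\ t\ge16\pi . \] -/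

import Mathlib

noncomputable section

/-- The integrand `x^{-s} e^{πi x²} / (e^{πi x} - e^{-πi x})` of Riemann's auxiliary function;
the power is taken with the principal branch of the logarithm. -/
def riemannAuxIntegrand (s x : ℂ) : ℂ :=
  x ^ (-s) * Complex.exp (Real.pi * Complex.I * x ^ 2) /
    (Complex.exp (Real.pi * Complex.I * x) - Complex.exp (-(Real.pi * Complex.I * x)))

/-- The straight line `u ↦ 1/2 + u e^{πi/4}`, of slope one, which crosses the real axis only
at `1/2`. -/
def riemannAuxLine (u : ℝ) : ℂ :=
  1 / 2 + u * Complex.exp (Real.pi * Complex.I / 4)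

/-- Riemann's auxiliary function
`R(s) = ∫_{0 ↙ 1} x^{-s} e^{πi x²} / (e^{πi x} - e^{-πi x}) dx`,
the integral being taken along a line of slope one that crosses the real axis between `0` and `1`,
run through from the upper right to the lower left. All such lines give the same value; we take
the one through `1/2`. On it `dx = e^{πi/4} du`, and the minus sign is the orientation `↙`. -/
def riemannAux (s : ℂ) : ℂ :=
  -∫ u : ℝ, riemannAuxIntegrand s (riemannAuxLine u) * Complex.exp (Real.pi * Complex.I / 4)

end

/-!
Push the line of integration to the right across the poles `1, …, N`: the residue at `n` contributes
`n⁻ˢ`, so the error in the theorem is minus the integral over the line of slope one through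
`c = N + 1/2`. Parametrise this line by its imaginary part `v` and let `a = √(t/2π)`, the saddle
point of `x⁻ˢ e^{πix²}`. The modulus of the integrand is
`½ ‖x‖^(-σ) exp(2π(a² arg x - c v - v²)) / |sin πx|`. Since `c` is within `1/2` of `a`, it is
dominated by a Gaussian for `-c/2 ≤ v ≤ 3c/8` and the two remaining tails are tiny. This gives the
bound for `σ = 0` and for `σ = 1`; the values in between follow from weighted AM-GM in the form
`(a/‖x‖)^σ ≤ (1 - σ) + σ a/‖x‖`, and `σ > 1` reduces to `σ = 1` because `‖x‖ ≥ 1` on the line.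
-/

open MeasureTheory Filter Topology
open scoped Real
open Complex (I)

/-- The filter of neighbourhoods of the two ends of the closed horizontal strip between the lines
`im w = a` and `im w = b`. -/
def stripEnds (a b : ℝ) : Filter ℂ :=
  comap (fun w => |w.re|) atTop ⊓ 𝓟 (Complex.im ⁻¹' Set.uIcc a b)

theorem eventually_stripEnds_iff {a b : ℝ} {p : ℂ → Prop} :
    (∀ᶠ w in stripEnds a b, p w) ↔ ∃ R : ℝ, ∀ w : ℂ, R ≤ |w.re| → w.im ∈ Set.uIcc a b → p w := by
  simp [stripEnds, ((atTop_basis.comap _).inf_principal _).eventually_iff]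

section Contour

variable {E : Type*} [NormedAddCommGroup E] [NormedSpace ℂ E] {f : ℂ → E} {a b : ℝ}

theorem tendsto_integral_vertical_zero {ι : Type*} {l : Filter ι} {T : ι → ℝ}
    (hf : Tendsto f (stripEnds a b) (𝓝 0)) (hT : Tendsto (fun i => |T i|) l atTop) :
    Tendsto (fun i => ∫ y : ℝ in a..b, f (T i + y * I)) l (𝓝 0) := by
  rw [NormedAddGroup.tendsto_nhds_zero] at hf ⊢
  intro ε hε
  have hδ : 0 < ε / (|b - a| + 1) := by positivity
  obtain ⟨R, hR⟩ := eventually_stripEnds_iff.1 (hf _ hδ)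
  filter_upwards [hT.eventually_ge_atTop R] with i hi
  calc ‖∫ y : ℝ in a..b, f (T i + y * I)‖ ≤ ε / (|b - a| + 1) * |b - a| :=
        intervalIntegral.norm_integral_le_of_norm_le_const fun y hy =>
          (hR _ (by simpa using hi) (by simpa using Set.uIoc_subset_uIcc hy)).le
    _ < ε := by rw [div_mul_eq_mul_div, div_lt_iff₀ (by positivity)]; gcongr; linarith

theorem integral_horizontal_sub_eq_zero [CompleteSpace E]
    (hd : DifferentiableOn ℂ f (Complex.im ⁻¹' Set.uIcc a b))
    (hf : Tendsto f (stripEnds a b) (𝓝 0))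
    (hi : Integrable fun x : ℝ => f (x + a * I) - f (x + b * I)) :
    ∫ x : ℝ, (f (x + a * I) - f (x + b * I)) = 0 := by
  have hint (T k : ℝ) (hk : k ∈ Set.uIcc a b) :
      IntervalIntegrable (fun x : ℝ => f (x + k * I)) volume (-T) T :=
    (hd.continuousOn.comp (by fun_prop) fun x _ => by simpa using hk).intervalIntegrable
  have hrect (T : ℝ) : ∫ x : ℝ in -T..T, (f (x + a * I) - f (x + b * I)) =
      I • (∫ y : ℝ in a..b, f ((-T : ℝ) + y * I)) - I • ∫ y : ℝ in a..b, f (T + y * I) := by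
    have := Complex.integral_boundary_rect_eq_zero_of_differentiableOn f ⟨-T, a⟩ ⟨T, b⟩
      (hd.mono fun w hw => hw.2)
    rw [intervalIntegral.integral_sub (hint T a Set.left_mem_uIcc) (hint T b Set.right_mem_uIcc)]
    rw [add_sub_assoc, add_eq_zero_iff_eq_neg, neg_sub] at this
    exact this
  refine tendsto_nhds_unique
    (intervalIntegral_tendsto_integral hi tendsto_neg_atTop_atBot tendsto_id) ?_
  have hside := ((tendsto_integral_vertical_zero hf
    (tendsto_abs_atBot_atTop.comp tendsto_neg_atTop_atBot)).const_smul I).sub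
    ((tendsto_integral_vertical_zero hf tendsto_abs_atTop_atTop).const_smul I)
  simpa only [id, hrect, smul_zero, sub_zero] using hside

end Contour

theorem add_mul_I_ne_zero (x : ℝ) {y : ℝ} (hy : y ≠ 0) : (x : ℂ) + y * I ≠ 0 :=
  fun h => hy (by simpa using congr(($h).im))

theorem inv_sub_inv_horizontal {b : ℝ} (hb : 0 < b) (x : ℝ) :
    ((x : ℂ) + (-b : ℝ) * I)⁻¹ - ((x : ℂ) + b * I)⁻¹ =
      2 * I / b * ((1 + (x / b) ^ 2)⁻¹ : ℝ) := by
  have hb' : (b : ℂ) ≠ 0 := by exact_mod_cast hb.ne'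
  have hsq : (b : ℂ) ^ 2 + x ^ 2 ≠ 0 := by
    exact_mod_cast (by positivity : b ^ 2 + x ^ 2 ≠ 0)
  have hprod : ((x : ℂ) + (-b : ℝ) * I) * (x + b * I) = b ^ 2 + x ^ 2 := by
    push_cast
    linear_combination -(b : ℂ) ^ 2 * Complex.I_sq
  rw [inv_sub_inv (add_mul_I_ne_zero x (neg_ne_zero.2 hb.ne'))
    (add_mul_I_ne_zero x hb.ne'), hprod]
  push_cast
  field_simp
  ring

theorem integrable_inv_sub_inv_horizontal {b : ℝ} (hb : 0 < b) :
    Integrable fun x : ℝ => ((x : ℂ) + (-b : ℝ) * I)⁻¹ - ((x : ℂ) + b * I)⁻¹ := by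
  simp_rw [inv_sub_inv_horizontal hb]
  exact (integrable_inv_one_add_sq.comp_div hb.ne').ofReal.const_mul _

theorem integral_inv_sub_inv_horizontal {b : ℝ} (hb : 0 < b) :
    ∫ x : ℝ, (((x : ℂ) + (-b : ℝ) * I)⁻¹ - ((x : ℂ) + b * I)⁻¹) = 2 * π * I := by
  have hb' : (b : ℂ) ≠ 0 := by exact_mod_cast hb.ne'
  simp_rw [inv_sub_inv_horizontal hb]
  rw [integral_const_mul, integral_complex_ofReal,
    Measure.integral_comp_div (fun x : ℝ => (1 + x ^ 2)⁻¹) b, integral_univ_inv_one_add_sq,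
    abs_of_pos hb, smul_eq_mul]
  push_cast
  field_simp

theorem exists_differentiableOn_eq_sub_residue {f : ℂ → ℂ} {S : Set ℂ} {r : ℂ} (hS : S ∈ 𝓝 0)
    (hd : DifferentiableOn ℂ f (S \ {0})) (hr : Tendsto (fun w => w * f w) (𝓝[≠] 0) (𝓝 r)) :
    ∃ g : ℂ → ℂ, DifferentiableOn ℂ g S ∧ ∀ w ≠ 0, g w = f w - r * w⁻¹ := by
  set h : ℂ → ℂ := fun w => f w - r * w⁻¹ with hh
  have hdiff : DifferentiableOn ℂ h (S \ {0}) :=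
    hd.sub ((differentiableOn_inv.mono fun w hw => hw.2).const_mul r)
  have hlittle : (fun w => h w - h 0) =o[𝓝[≠] 0] fun w => (w - 0)⁻¹ := by
    refine (Asymptotics.isLittleO_iff_tendsto' ?_).2 ?_
    · filter_upwards [self_mem_nhdsWithin] with w hw h0
      exact absurd (by simpa using h0) hw
    · have hlim : Tendsto (fun w : ℂ => w * f w - r - w * h 0) (𝓝[≠] 0) (𝓝 (r - r - 0 * h 0)) :=
        (hr.sub_const r).sub ((tendsto_id.mono_left nhdsWithin_le_nhds).mul_const _)
      rw [sub_self, zero_mul, sub_zero] at hlim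
      refine hlim.congr' ?_
      filter_upwards [self_mem_nhdsWithin] with w (hw : w ≠ 0)
      simp only [hh, sub_zero, div_inv_eq_mul]
      field_simp
  exact ⟨_, Complex.differentiableOn_update_limUnder_of_isLittleO hS hdiff hlittle,
    fun w hw => Function.update_of_ne hw _ _⟩

theorem integral_horizontal_sub_eq_two_pi_I_mul_residue {f : ℂ → ℂ} {b : ℝ} {r : ℂ} (hb : 0 < b)
    (hd : DifferentiableOn ℂ f (Complex.im ⁻¹' Set.uIcc (-b) b \ {0}))
    (hr : Tendsto (fun w => w * f w) (𝓝[≠] 0) (𝓝 r)) (hf : Tendsto f (stripEnds (-b) b) (𝓝 0))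
    (hi₁ : Integrable fun x : ℝ => f (x + (-b : ℝ) * I))
    (hi₂ : Integrable fun x : ℝ => f (x + b * I)) :
    (∫ x : ℝ, f (x + (-b : ℝ) * I)) - ∫ x : ℝ, f (x + b * I) = 2 * π * I * r := by
  have hS : Complex.im ⁻¹' Set.uIcc (-b) b ∈ 𝓝 0 :=
    Complex.continuous_im.continuousAt.preimage_mem_nhds
      (by rw [Set.uIcc_of_le (by linarith)]; exact Icc_mem_nhds (by simpa) (by simpa))
  obtain ⟨g, hgd, hg⟩ := exists_differentiableOn_eq_sub_residue hS hd hr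
  have hline (x : ℝ) : g (x + (-b : ℝ) * I) - g (x + b * I) =
      (f (x + (-b : ℝ) * I) - f (x + b * I)) -
        r * (((x : ℂ) + (-b : ℝ) * I)⁻¹ - ((x : ℂ) + b * I)⁻¹) := by
    rw [hg _ (add_mul_I_ne_zero x (neg_ne_zero.2 hb.ne')), hg _ (add_mul_I_ne_zero x hb.ne')]
    ring
  have hends : Tendsto g (stripEnds (-b) b) (𝓝 0) := by
    have hinv : Tendsto (fun w : ℂ => w⁻¹) (stripEnds (-b) b) (𝓝 0) :=
      tendsto_inv₀_cobounded.comp <| tendsto_norm_atTop_iff_cobounded.1 <|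
        tendsto_atTop_mono Complex.abs_re_le_norm (tendsto_comap.mono_left inf_le_left)
    have hlim := hf.sub (hinv.const_mul r)
    rw [mul_zero, sub_zero] at hlim
    refine hlim.congr' (eventually_stripEnds_iff.2 ⟨1, fun w hw _ => (hg w ?_).symm⟩)
    rintro rfl
    norm_num at hw
  have hf_sub : Integrable fun x : ℝ => f (x + (-b : ℝ) * I) - f (x + b * I) := hi₁.sub hi₂
  have hinv_sub := (integrable_inv_sub_inv_horizontal hb).const_mul r
  have hzero := integral_horizontal_sub_eq_zero hgd hends
    ((hf_sub.sub hinv_sub).congr (Eventually.of_forall fun x => (hline x).symm))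
  simp_rw [hline] at hzero
  rw [integral_sub hf_sub hinv_sub, integral_sub hi₁ hi₂, integral_const_mul,
    integral_inv_sub_inv_horizontal hb] at hzero
  linear_combination hzero

theorem integrable_exp_two_pi_mul_quadratic (p : ℝ) {q : ℝ} (hq : 0 < q) :
    Integrable fun v : ℝ => Real.exp (2 * π * (p * v - q * v ^ 2)) := by
  have h := ((integrable_exp_neg_mul_sq (b := 2 * π * q) (by positivity)).comp_sub_right
    (p / (2 * q))).const_mul (Real.exp (π * p ^ 2 / (2 * q)))
  refine h.congr (Eventually.of_forall fun v => ?_)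
  simp only [← Real.exp_add]
  congr 1
  field_simp
  ring

theorem integral_exp_two_pi_mul_quadratic (p : ℝ) {q : ℝ} (hq : 0 < q) :
    ∫ v : ℝ, Real.exp (2 * π * (p * v - q * v ^ 2)) =
      Real.exp (π * p ^ 2 / (2 * q)) / √(2 * q) := by
  have hsqrt : √(π / (2 * π * q)) = (√(2 * q))⁻¹ := by
    rw [← Real.sqrt_inv]
    congr 1
    field_simp
  rw [div_eq_mul_inv, ← hsqrt, ← integral_gaussian,
    ← integral_sub_right_eq_self (fun v : ℝ => Real.exp (-(2 * π * q) * v ^ 2)) (p / (2 * q)),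
    ← integral_const_mul]
  refine integral_congr_ae (Eventually.of_forall fun v => ?_)
  simp only [← Real.exp_add]
  congr 1
  field_simp
  ring

theorem tendsto_exp_two_pi_mul_quadratic_atTop (p : ℝ) {q : ℝ} (hq : 0 < q) :
    Tendsto (fun v : ℝ => Real.exp (2 * π * (p * v - q * v ^ 2))) atTop (𝓝 0) := by
  have hlin : Tendsto (fun v : ℝ => p - q * v) atTop atBot :=
    tendsto_atBot_add_const_left _ p (tendsto_neg_atTop_atBot.comp (tendsto_id.const_mul_atTop hq))
  refine Real.tendsto_exp_atBot.comp
    (((tendsto_id.atTop_mul_atBot₀ hlin).const_mul_atBot Real.two_pi_pos).congr fun v => ?_)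
  simp only [id]
  ring

theorem norm_sin_sq (z : ℂ) : ‖Complex.sin z‖ ^ 2 = Real.sin z.re ^ 2 + Real.sinh z.im ^ 2 := by
  rw [Complex.sq_norm, Complex.sin_eq, ← Complex.ofReal_sin, ← Complex.ofReal_cosh,
    ← Complex.ofReal_cos, ← Complex.ofReal_sinh, ← Complex.ofReal_mul, ← Complex.ofReal_mul,
    Complex.normSq_add_mul_I]
  linear_combination Real.sin z.re ^ 2 * Real.cosh_sq z.im +
    Real.sinh z.im ^ 2 * Real.sin_sq_add_cos_sq z.re

theorem abs_sinh_im_le_norm_sin (z : ℂ) : |Real.sinh z.im| ≤ ‖Complex.sin z‖ := by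
  refine abs_le_of_sq_le_sq' ?_ (norm_nonneg _) |> abs_le.2
  rw [norm_sin_sq]
  exact le_add_of_nonneg_left (sq_nonneg _)

theorem two_le_sinh_half_pi : 2 ≤ Real.sinh (π / 2) := by
  have hexp : 4.5 ≤ Real.exp (π / 2) := by
    calc (4.5 : ℝ) ≤ ∑ i ∈ Finset.range 6, (1.57 : ℝ) ^ i / i.factorial := by
          norm_num [Finset.sum_range_succ, Nat.factorial]
      _ ≤ Real.exp 1.57 := Real.sum_le_exp_of_nonneg (by norm_num) 6
      _ ≤ Real.exp (π / 2) := by gcongr; linarith [Real.pi_gt_d2]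
  have hexp_neg : Real.exp (-(π / 2)) ≤ 1 / 4.5 := by
    rw [Real.exp_neg, ← one_div]
    gcongr
  rw [Real.sinh_eq]
  norm_num at hexp_neg ⊢
  linarith

theorem two_le_norm_sin_pi_mul {x : ℂ} (hx : 1 / 2 ≤ |x.im|) : 2 ≤ ‖Complex.sin (π * x)‖ :=
  calc 2 ≤ Real.sinh (π / 2) := two_le_sinh_half_pi
    _ ≤ Real.sinh (π * |x.im|) := Real.sinh_le_sinh.2 (by nlinarith [Real.pi_pos])
    _ = |Real.sinh (π * x : ℂ).im| := by
      rw [Real.abs_sinh, Complex.im_ofReal_mul, abs_mul, abs_of_pos Real.pi_pos]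
    _ ≤ ‖Complex.sin (π * x)‖ := abs_sinh_im_le_norm_sin _

section Integrand

variable {s x : ℂ}

theorem riemannAuxIntegrand_eq (s x : ℂ) :
    riemannAuxIntegrand s x =
      x ^ (-s) * Complex.exp (π * I * x ^ 2) / (2 * I * Complex.sin (π * x)) := by
  have hsin : Complex.exp (π * I * x) - Complex.exp (-(π * I * x)) =
      2 * I * Complex.sin (π * x) := by
    rw [Complex.sin, show -(π * x : ℂ) * I = -(π * I * x) by ring,
      show (π * x : ℂ) * I = π * I * x by ring]
    linear_combination
      -(Complex.exp (-(π * I * x)) - Complex.exp (π * I * x)) * Complex.I_sq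
  rw [riemannAuxIntegrand, hsin]

theorem norm_riemannAuxIntegrand (s : ℂ) (hx : x ≠ 0) :
    ‖riemannAuxIntegrand s x‖ = ‖x‖ ^ (-s.re) *
      Real.exp (s.im * x.arg - 2 * π * (x.re * x.im)) / (2 * ‖Complex.sin (π * x)‖) := by
  have hre : (π * I * x ^ 2).re = -(2 * π * (x.re * x.im)) := by
    simp only [sq, Complex.mul_re, Complex.mul_im, Complex.ofReal_re, Complex.ofReal_im,
      Complex.I_re, Complex.I_im]
    ring
  rw [riemannAuxIntegrand_eq, norm_div, norm_mul, norm_mul, norm_mul,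
    Complex.norm_cpow_of_ne_zero hx, Complex.norm_exp, Complex.norm_I, hre, Complex.neg_re,
    Complex.neg_im, mul_neg, Real.exp_neg, div_inv_eq_mul, mul_assoc, ← Real.exp_add,
    Complex.norm_ofNat, mul_one]
  ring_nf

theorem differentiableAt_riemannAuxIntegrand (hx : x ∈ Complex.slitPlane)
    (hsin : Complex.sin (π * x) ≠ 0) : DifferentiableAt ℂ (riemannAuxIntegrand s) x := by
  rw [funext (riemannAuxIntegrand_eq s)]
  refine DifferentiableAt.div (.mul ?_ (by fun_prop)) (by fun_prop)
    (mul_ne_zero (mul_ne_zero two_ne_zero Complex.I_ne_zero) hsin)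
  exact differentiableAt_id.cpow (differentiableAt_const _) hx

theorem tendsto_sub_natCast_mul_riemannAuxIntegrand (s : ℂ) {n : ℕ} (hn : n ≠ 0) :
    Tendsto (fun x => (x - n) * riemannAuxIntegrand s x) (𝓝[≠] (n : ℂ))
      (𝓝 ((n : ℂ) ^ (-s) / (2 * π * I))) := by
  have hπ : (π : ℂ) ≠ 0 := by exact_mod_cast Real.pi_ne_zero
  have hcos : Complex.cos (π * n) = (-1) ^ n := by
    exact_mod_cast congrArg ((↑) : ℝ → ℂ) ((mul_comm (n : ℝ) π) ▸ Real.cos_nat_mul_pi n)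
  have hsin : Complex.sin (π * n) = 0 := by rw [mul_comm, Complex.sin_nat_mul_pi]
  have hexp : Complex.exp (π * I * (n : ℂ) ^ 2) = (-1) ^ n := by
    rw [show π * I * (n : ℂ) ^ 2 = ((n ^ 2 : ℕ) : ℂ) * (π * I) by push_cast; ring,
      Complex.exp_nat_mul, Complex.exp_pi_mul_I]
    rcases n.even_or_odd with h | h
    · simp [h.neg_one_pow, h.pow_of_ne_zero]
    · simp [h.neg_one_pow, h.pow]
  have hslope : Tendsto (fun x => (slope (fun x => Complex.sin (π * x)) (n : ℂ) x)⁻¹) (𝓝[≠] (n : ℂ))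
      (𝓝 ((-1 : ℂ) ^ n * π)⁻¹) := by
    have hderiv : HasDerivAt (fun x => Complex.sin (π * x)) ((-1) ^ n * π) (n : ℂ) := by
      simpa [hcos] using ((hasDerivAt_id (n : ℂ)).const_mul (π : ℂ)).csin
    exact hderiv.tendsto_slope.inv₀ (mul_ne_zero (pow_ne_zero _ (by norm_num)) hπ)
  have hnum : ContinuousAt (fun x => x ^ (-s) * Complex.exp (π * I * x ^ 2) / (2 * I)) (n : ℂ) := by
    have hmem : (n : ℂ) ∈ Complex.slitPlane := Complex.natCast_mem_slitPlane.2 hn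
    exact ((continuousAt_id.cpow continuousAt_const hmem).mul (by fun_prop)).div_const _
  have hlim := (hnum.tendsto.mono_left nhdsWithin_le_nhds).mul hslope
  have hval : (n : ℂ) ^ (-s) * Complex.exp (π * I * (n : ℂ) ^ 2) / (2 * I) * ((-1 : ℂ) ^ n * π)⁻¹ =
      (n : ℂ) ^ (-s) / (2 * π * I) := by
    have hsign : ((-1 : ℂ)) ^ n ≠ 0 := pow_ne_zero _ (by norm_num)
    rw [hexp]
    field_simp
  rw [hval] at hlim
  refine hlim.congr fun x => ?_
  rw [riemannAuxIntegrand_eq, slope_def_field, hsin, sub_zero, inv_div]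
  ring

end Integrand

/-- The line of slope one which crosses the real axis at `c`, parametrized by its imaginary part. -/
noncomputable def diagonal (c v : ℝ) : ℂ := c + v * (1 + I)

theorem diagonal_re (c v : ℝ) : (diagonal c v).re = c + v := by simp [diagonal]

theorem diagonal_im (c v : ℝ) : (diagonal c v).im = v := by simp [diagonal]

theorem continuous_diagonal (c : ℝ) : Continuous (diagonal c) := by
  unfold diagonal
  fun_prop

theorem norm_diagonal_sq (c v : ℝ) : ‖diagonal c v‖ ^ 2 = (c + v) ^ 2 + v ^ 2 := by
  rw [Complex.sq_norm, Complex.normSq_apply, diagonal_re, diagonal_im, sq, sq]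

theorem div_sqrt_two_le_norm_diagonal (c v : ℝ) : c / √2 ≤ ‖diagonal c v‖ := by
  refine le_of_sq_le_sq ?_ (norm_nonneg _)
  rw [norm_diagonal_sq, div_pow, Real.sq_sqrt zero_le_two]
  nlinarith [sq_nonneg (c + 2 * v)]

theorem add_mul_one_add_I_eq_diagonal (c : ℝ) (w : ℂ) :
    c + w * (1 + I) = diagonal (c - 2 * w.im) (w.re + w.im) := by
  apply Complex.ext
  · simp [diagonal]
    ring
  · simp [diagonal]

theorem diagonal_mem_slitPlane {c : ℝ} (hc : 0 < c) (v : ℝ) :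
    diagonal c v ∈ Complex.slitPlane := by
  rw [Complex.mem_slitPlane_iff, diagonal_re, diagonal_im]
  by_cases hv : v = 0
  · exact .inl (by simpa [hv] using hc)
  · exact .inr hv

theorem diagonal_ne_zero {c : ℝ} (hc : 0 < c) (v : ℝ) : diagonal c v ≠ 0 :=
  Complex.slitPlane_ne_zero (diagonal_mem_slitPlane hc v)

theorem one_le_norm_sin_pi_mul_diagonal_add_half (m : ℕ) (v : ℝ) :
    1 ≤ ‖Complex.sin (π * diagonal (m + 1 / 2) v)‖ := by
  refine le_of_sq_le_sq ?_ (norm_nonneg _)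
  have hsin : Real.sin (π * (m + 1 / 2 + v)) ^ 2 = Real.cos (π * v) ^ 2 := by
    rw [show π * (m + 1 / 2 + v) = π * v + π / 2 + m * π by ring, Real.sin_add_nat_mul_pi,
      Real.sin_add_pi_div_two, mul_pow, ← pow_mul, mul_comm m, pow_mul, neg_one_sq, one_pow,
        one_mul]
  have hsinh : Real.sin (π * v) ^ 2 ≤ Real.sinh (π * v) ^ 2 := by
    rw [sq_le_sq]
    calc |Real.sin (π * v)| ≤ |π * v| := Real.abs_sin_le_abs
      _ ≤ Real.sinh |π * v| := Real.self_le_sinh_iff.2 (abs_nonneg _)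
      _ = |Real.sinh (π * v)| := (Real.abs_sinh _).symm
  rw [norm_sin_sq, Complex.re_ofReal_mul, Complex.im_ofReal_mul, diagonal_re, diagonal_im, hsin]
  linarith [Real.sin_sq_add_cos_sq (π * v)]

section DiagonalIntegral

variable {s : ℂ} {c v : ℝ}

theorem norm_riemannAuxIntegrand_diagonal_le (hs : 0 ≤ s.re) (hc : 0 < c)
    (hsin : 1 ≤ ‖Complex.sin (π * diagonal c v)‖) :
    ‖riemannAuxIntegrand s (diagonal c v)‖ ≤
      (c / √2) ^ (-s.re) * Real.exp (π * |s.im|) * Real.exp (2 * π * (-c * v - 1 * v ^ 2)) := by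
  have harg : s.im * (diagonal c v).arg ≤ π * |s.im| :=
    calc s.im * (diagonal c v).arg ≤ |s.im * (diagonal c v).arg| := le_abs_self _
      _ = |(diagonal c v).arg| * |s.im| := by rw [abs_mul, mul_comm]
      _ ≤ π * |s.im| := by gcongr; exact Complex.abs_arg_le_pi _
  rw [norm_riemannAuxIntegrand s (diagonal_ne_zero hc v), mul_assoc _ (Real.exp _), ← Real.exp_add]
  refine (div_le_self (by positivity) (by linarith)).trans ?_
  refine mul_le_mul ?_ (Real.exp_le_exp.2 ?_) (by positivity) (by positivity)
  · exact Real.rpow_le_rpow_of_nonpos (by positivity) (div_sqrt_two_le_norm_diagonal c v)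
      (by linarith)
  · rw [diagonal_re, diagonal_im]
    linarith

theorem continuous_riemannAuxIntegrand_diagonal_add_half (s : ℂ) (m : ℕ) :
    Continuous fun v => riemannAuxIntegrand s (diagonal (m + 1 / 2) v) := by
  refine continuous_iff_continuousAt.2 fun v => ?_
  have hd := differentiableAt_riemannAuxIntegrand (s := s)
    (diagonal_mem_slitPlane (by positivity : (0 : ℝ) < m + 1 / 2) v)
    (norm_pos_iff.1 (zero_lt_one.trans_le (one_le_norm_sin_pi_mul_diagonal_add_half m v)))
  exact hd.continuousAt.comp (continuous_diagonal _).continuousAt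

theorem integrable_riemannAuxIntegrand_diagonal_add_half (hs : 0 ≤ s.re) (m : ℕ) :
    Integrable fun v => riemannAuxIntegrand s (diagonal (m + 1 / 2) v) :=
  ((integrable_exp_two_pi_mul_quadratic _ one_pos).const_mul _).mono'
    (continuous_riemannAuxIntegrand_diagonal_add_half s m).aestronglyMeasurable
    (Eventually.of_forall fun v => norm_riemannAuxIntegrand_diagonal_le hs (by positivity)
      (one_le_norm_sin_pi_mul_diagonal_add_half m v))

/-- The integral defining `riemannAux`, over the line of slope one through `c` run through from the
lower left to the upper right. -/
noncomputable def diagonalIntegral (s : ℂ) (c : ℝ) : ℂ :=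
  ∫ v : ℝ, riemannAuxIntegrand s (diagonal c v) * (1 + I)

theorem exp_pi_mul_I_div_four : Complex.exp (π * I / 4) = (1 + I) / √2 := by
  have hsq : ((√2 : ℝ) : ℂ) ^ 2 = 2 := by exact_mod_cast Real.sq_sqrt zero_le_two
  have hne : ((√2 : ℝ) : ℂ) ≠ 0 := by exact_mod_cast (Real.sqrt_pos.2 two_pos).ne'
  rw [show π * I / 4 = ((π / 4 : ℝ) : ℂ) * I by push_cast; ring, Complex.exp_mul_I,
    ← Complex.ofReal_cos, ← Complex.ofReal_sin, Real.cos_pi_div_four, Real.sin_pi_div_four]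
  push_cast
  field_simp
  linear_combination (1 + I) * hsq

theorem riemannAux_eq_neg_diagonalIntegral (s : ℂ) :
    riemannAux s = -diagonalIntegral s (1 / 2) := by
  have hne : ((√2 : ℝ) : ℂ) ≠ 0 := by exact_mod_cast (Real.sqrt_pos.2 two_pos).ne'
  have hscale := Measure.integral_comp_div
    (fun v : ℝ => riemannAuxIntegrand s (diagonal (1 / 2) v) * (1 + I)) √2
  rw [abs_of_pos (Real.sqrt_pos.2 two_pos), Complex.real_smul] at hscale
  rw [riemannAux, diagonalIntegral, neg_inj, ← mul_right_inj' hne, ← hscale, ← integral_const_mul]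
  refine integral_congr_ae (Eventually.of_forall fun u => ?_)
  have hline : riemannAuxLine u = diagonal (1 / 2) (u / √2) := by
    rw [riemannAuxLine, diagonal, exp_pi_mul_I_div_four]
    push_cast
    ring
  simp only [hline, exp_pi_mul_I_div_four]
  field_simp

theorem one_add_I_ne_zero : 1 + I ≠ 0 := fun h => by simpa using congr(($h).re)

theorem sin_pi_mul_ne_zero_of_abs_im_lt {n : ℕ} {w : ℂ} (hw : |w.im| < 1 / 2) (hw0 : w ≠ 0) :
    Complex.sin (π * (n + w * (1 + I))) ≠ 0 := by
  intro hsin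
  obtain ⟨k, hk⟩ := Complex.sin_eq_zero_iff.1 hsin
  have hx : n + w * (1 + I) = k :=
    mul_left_cancel₀ (Complex.ofReal_ne_zero.2 Real.pi_ne_zero) (hk.trans (mul_comm _ _))
  have him : w.re + w.im = 0 := by simpa using congr(($hx).im)
  have hre : (n : ℝ) + (w.re - w.im) = k := by simpa using congr(($hx).re)
  have hkn : k - n = 0 := by
    refine Int.abs_lt_one_iff.1 ?_
    have : |((k - n : ℤ) : ℝ)| < 1 := by
      rw [show ((k - n : ℤ) : ℝ) = -(2 * w.im) by push_cast; linarith, abs_neg, abs_mul, abs_two]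
      linarith
    exact_mod_cast this
  have hkn' : (k : ℝ) = n := by exact_mod_cast sub_eq_zero.1 hkn
  exact hw0 (Complex.ext (by simp; linarith) (by simp; linarith))

theorem tendsto_riemannAuxIntegrand_stripEnds (hs : 0 ≤ s.re) {n : ℕ} (hn : n ≠ 0) :
    Tendsto (fun w => riemannAuxIntegrand s (n + w * (1 + I))) (stripEnds (-(1 / 4)) (1 / 4))
      (𝓝 0) := by
  have hn1 : (1 : ℝ) ≤ n := by exact_mod_cast Nat.one_le_iff_ne_zero.2 hn
  have hn2 : (0 : ℝ) < n - 1 / 2 := by linarith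
  have hheight : Tendsto (fun w : ℂ => |w.re + w.im|) (stripEnds (-(1 / 4)) (1 / 4)) atTop := by
    refine tendsto_atTop.2 fun R => eventually_stripEnds_iff.2 ⟨R + 1 / 4, fun w hw him => ?_⟩
    rw [Set.uIcc_of_le (by norm_num), Set.mem_Icc, ← abs_le] at him
    have := abs_sub_abs_le_abs_sub w.re (-w.im)
    rw [abs_neg, sub_neg_eq_add] at this
    linarith
  have hlim := ((tendsto_exp_two_pi_mul_quadratic_atTop (n + 1 / 2) one_pos).comp hheight).const_mul
    (((n - 1 / 2) / √2) ^ (-s.re) * Real.exp (π * |s.im|))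
  rw [mul_zero] at hlim
  refine squeeze_zero_norm' ?_ hlim
  filter_upwards [hheight.eventually_ge_atTop (1 / 2),
    eventually_stripEnds_iff.2 ⟨0, fun w _ him => him⟩] with w hv him
  rw [Set.uIcc_of_le (by norm_num)] at him
  obtain ⟨him₁, him₂⟩ := him
  rw [← Complex.ofReal_natCast, add_mul_one_add_I_eq_diagonal]
  have hc : 0 < n - 2 * w.im := by linarith
  refine (norm_riemannAuxIntegrand_diagonal_le hs hc ?_).trans ?_
  · exact one_le_two.trans (two_le_norm_sin_pi_mul (by rwa [diagonal_im]))
  · refine mul_le_mul (mul_le_mul_of_nonneg_right ?_ (by positivity)) (Real.exp_le_exp.2 ?_)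
      (by positivity) (by positivity)
    · refine Real.rpow_le_rpow_of_nonpos (by positivity) ?_ (by linarith)
      gcongr
      linarith
    · simp only [sq_abs]
      gcongr 2 * π * (?_ - _)
      calc -(n - 2 * w.im) * (w.re + w.im) ≤ |-(n - 2 * w.im) * (w.re + w.im)| := le_abs_self _
        _ = (n - 2 * w.im) * |w.re + w.im| := by rw [abs_mul, abs_neg, abs_of_pos hc]
        _ ≤ (n + 1 / 2) * |w.re + w.im| := by gcongr; linarith

theorem diagonalIntegral_eq_integral_horizontal (s : ℂ) (c k : ℝ) :
    diagonalIntegral s (c - 2 * k) =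
      (∫ x : ℝ, riemannAuxIntegrand s (c + (x + k * I) * (1 + I))) * (1 + I) := by
  rw [diagonalIntegral, integral_mul_const,
    ← integral_add_right_eq_self (fun v => riemannAuxIntegrand s (diagonal (c - 2 * k) v)) k]
  simp [add_mul_one_add_I_eq_diagonal]

theorem differentiableOn_riemannAuxIntegrand_strip (s : ℂ) {n : ℕ} (hn : n ≠ 0) :
    DifferentiableOn ℂ (fun w => riemannAuxIntegrand s (n + w * (1 + I)))
      (Complex.im ⁻¹' Set.uIcc (-(1 / 4)) (1 / 4) \ {0}) := by
  rintro w ⟨him, hw0⟩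
  rw [Set.uIcc_of_le (by norm_num), Set.mem_preimage, Set.mem_Icc] at him
  have hn1 : (1 : ℝ) ≤ n := by exact_mod_cast Nat.one_le_iff_ne_zero.2 hn
  have hslit : n + w * (1 + I) ∈ Complex.slitPlane := by
    rw [← Complex.ofReal_natCast, add_mul_one_add_I_eq_diagonal]
    exact diagonal_mem_slitPlane (by linarith) _
  have hsin := sin_pi_mul_ne_zero_of_abs_im_lt (n := n)
    ((abs_le.2 him).trans_lt (by norm_num)) hw0
  exact (DifferentiableAt.comp (f := fun w : ℂ => n + w * (1 + I)) w
    (differentiableAt_riemannAuxIntegrand hslit hsin) (by fun_prop)).differentiableWithinAt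

theorem tendsto_mul_riemannAuxIntegrand_zero (s : ℂ) {n : ℕ} (hn : n ≠ 0) :
    Tendsto (fun w => w * riemannAuxIntegrand s (n + w * (1 + I))) (𝓝[≠] 0)
      (𝓝 ((n : ℂ) ^ (-s) / (2 * π * I) / (1 + I))) := by
  have hline : Tendsto (fun w => n + w * (1 + I)) (𝓝[≠] 0) (𝓝[≠] (n : ℂ)) := by
    refine tendsto_nhdsWithin_iff.2 ⟨(Continuous.tendsto' (by fun_prop) 0 _ (by simp)).mono_left
      nhdsWithin_le_nhds, ?_⟩
    filter_upwards [self_mem_nhdsWithin] with w hw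
    simpa [one_add_I_ne_zero] using hw
  refine (((tendsto_sub_natCast_mul_riemannAuxIntegrand s hn).comp hline).div_const
    (1 + I)).congr fun w => ?_
  have := one_add_I_ne_zero
  simp only [Function.comp_apply, add_sub_cancel_left]
  field_simp

theorem integrable_riemannAuxIntegrand_horizontal (hs : 0 ≤ s.re) {c k : ℝ} {m : ℕ}
    (hm : c - 2 * k = m + 1 / 2) :
    Integrable fun x : ℝ => riemannAuxIntegrand s (c + (x + k * I) * (1 + I)) := by
  have := (integrable_riemannAuxIntegrand_diagonal_add_half hs m).comp_add_right k
  rw [← hm] at this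
  simpa [add_mul_one_add_I_eq_diagonal] using this

theorem diagonalIntegral_add_half_sub (hs : 0 ≤ s.re) (m : ℕ) :
    diagonalIntegral s ((m + 1 : ℕ) + 1 / 2) - diagonalIntegral s (m + 1 / 2) =
      1 / ((m + 1 : ℕ) : ℂ) ^ s := by
  set n : ℕ := m + 1 with hn
  have hn0 : n ≠ 0 := m.succ_ne_zero
  have hright : (n : ℝ) - 2 * -(1 / 4) = n + 1 / 2 := by ring
  have hleft : (n : ℝ) - 2 * (1 / 4) = m + 1 / 2 := by rw [hn]; push_cast; ring
  have key := integral_horizontal_sub_eq_two_pi_I_mul_residue (by norm_num)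
    (differentiableOn_riemannAuxIntegrand_strip s hn0) (tendsto_mul_riemannAuxIntegrand_zero s hn0)
    (tendsto_riemannAuxIntegrand_stripEnds hs hn0)
    (integrable_riemannAuxIntegrand_horizontal hs hright)
    (integrable_riemannAuxIntegrand_horizontal hs hleft)
  rw [← Complex.ofReal_natCast] at key
  rw [← hright, ← hleft, diagonalIntegral_eq_integral_horizontal,
    diagonalIntegral_eq_integral_horizontal, ← sub_mul, key, Complex.ofReal_natCast,
    Complex.cpow_neg]
  have := one_add_I_ne_zero
  field_simp [Complex.two_pi_I_ne_zero]

theorem riemannAux_sub_sum (hs : 0 ≤ s.re) (N : ℕ) :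
    riemannAux s - ∑ n ∈ Finset.Icc 1 N, 1 / (n : ℂ) ^ s = -diagonalIntegral s (N + 1 / 2) := by
  induction N with
  | zero => simp [riemannAux_eq_neg_diagonalIntegral]
  | succ m ih =>
    rw [Finset.sum_Icc_succ_top (by omega), ← sub_sub, ih, ← diagonalIntegral_add_half_sub hs m]
    ring

end DiagonalIntegral

section Calculus

variable {x y z : ℝ}

theorem le_of_hasDerivAt_nonneg {f f' : ℝ → ℝ} (hxy : x ≤ y)
    (hf : ∀ z ∈ Set.Icc x y, HasDerivAt f (f' z) z) (hf' : ∀ z ∈ Set.Icc x y, 0 ≤ f' z) :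
    f x ≤ f y := by
  refine monotoneOn_of_deriv_nonneg (convex_Icc x y)
    (fun z hz => (hf z hz).continuousAt.continuousWithinAt)
    (fun z hz => (hf z (interior_subset hz)).differentiableAt.differentiableWithinAt)
    (fun z hz => ?_) (Set.left_mem_Icc.2 hxy) (Set.right_mem_Icc.2 hxy) hxy
  rw [(hf z (interior_subset hz)).deriv]
  exact hf' z (interior_subset hz)

theorem one_add_two_mul_add_two_mul_sq_pos (z : ℝ) : 0 < 1 + 2 * z + 2 * z ^ 2 := by
  nlinarith [sq_nonneg (1 + 2 * z)]

theorem hasDerivAt_arctan_div_one_add (hz : -1 < z) :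
    HasDerivAt (fun z : ℝ => Real.arctan (z / (1 + z))) (1 / (1 + 2 * z + 2 * z ^ 2)) z := by
  have h0 : 1 + z ≠ 0 := by linarith
  have hquot := (hasDerivAt_id z).div ((hasDerivAt_id z).const_add 1) h0
  refine hquot.arctan.congr_deriv ?_
  have hpos := one_add_two_mul_add_two_mul_sq_pos z
  have hsq : 1 + (z / (1 + z)) ^ 2 = (1 + 2 * z + 2 * z ^ 2) / (1 + z) ^ 2 := by
    field_simp
    ring
  simp only [id, Pi.div_apply, hsq]
  field_simp
  ring

theorem arctan_div_one_add_le_cubic (hz : 0 ≤ z) :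
    Real.arctan (z / (1 + z)) ≤ z - z ^ 2 + 2 / 3 * z ^ 3 := by
  have hderiv : ∀ y ∈ Set.Icc 0 z, HasDerivAt
      (fun z => z - z ^ 2 + 2 / 3 * z ^ 3 - Real.arctan (z / (1 + z)))
      (1 - 2 * y + 2 * y ^ 2 - 1 / (1 + 2 * y + 2 * y ^ 2)) y := fun y hy => by
    refine ((((hasDerivAt_id y).sub (hasDerivAt_pow 2 y)).add ((hasDerivAt_pow 3 y).const_mul
      (2 / 3))).sub (hasDerivAt_arctan_div_one_add (by linarith [hy.1]))).congr_deriv ?_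
    norm_num
    ring
  have hmono := le_of_hasDerivAt_nonneg hz hderiv fun y _ => by
    rw [sub_nonneg, div_le_iff₀ (one_add_two_mul_add_two_mul_sq_pos y)]
    nlinarith [sq_nonneg (y ^ 2)]
  norm_num at hmono
  exact hmono

theorem arctan_div_one_add_le_quadratic_of_nonpos (hz : -1 / 2 ≤ z) (hz0 : z ≤ 0) :
    Real.arctan (z / (1 + z)) ≤ z - 3 / 4 * z ^ 2 := by
  have hderiv : ∀ y ∈ Set.Icc z 0, HasDerivAt
      (fun z => Real.arctan (z / (1 + z)) - (z - 3 / 4 * z ^ 2))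
      (1 / (1 + 2 * y + 2 * y ^ 2) - (1 - 3 / 2 * y)) y := fun y hy => by
    refine ((hasDerivAt_arctan_div_one_add (by linarith [hy.1])).sub
      ((hasDerivAt_id y).sub ((hasDerivAt_pow 2 y).const_mul (3 / 4)))).congr_deriv ?_
    norm_num
    ring
  have hmono := le_of_hasDerivAt_nonneg hz0 hderiv fun y hy => by
    rw [sub_nonneg, le_div_iff₀ (one_add_two_mul_add_two_mul_sq_pos y)]
    have hy1 : -1 / 2 ≤ y := hz.trans hy.1
    have hfactor : 0 ≤ 1 / 2 - y - 3 * y ^ 2 := by nlinarith [hy.2]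
    nlinarith [mul_nonneg (neg_nonneg.2 hy.2) hfactor]
  norm_num at hmono
  exact hmono

theorem arctan_div_one_add_le_quadratic (hz : -1 / 2 ≤ z) (hz1 : z ≤ 3 / 8) :
    Real.arctan (z / (1 + z)) ≤ z - 3 / 4 * z ^ 2 := by
  rcases le_total z 0 with h | h
  · exact arctan_div_one_add_le_quadratic_of_nonpos hz h
  · nlinarith [arctan_div_one_add_le_cubic h, mul_nonneg (sq_nonneg z) (sub_nonneg.2 hz1)]

theorem arctan_div_one_add_le_linear (hz : 3 / 8 ≤ z) :
    Real.arctan (z / (1 + z)) ≤ 0.2696 + (z - 3 / 8) / 2 := by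
  have hmono := le_of_hasDerivAt_nonneg (f := fun z => z / 2 - Real.arctan (z / (1 + z))) hz
    (fun y hy => ((hasDerivAt_id y).div_const 2).sub
      (hasDerivAt_arctan_div_one_add (by linarith [hy.1])))
    fun y hy => by
      rw [sub_nonneg, div_le_iff₀ (one_add_two_mul_add_two_mul_sq_pos y)]
      nlinarith [hy.1]
  have hstart := arctan_div_one_add_le_cubic (z := 3 / 8) (by norm_num)
  norm_num at hstart hmono ⊢
  linarith

theorem hasDerivAt_log_sub_quadratic (y : ℝ) :
    HasDerivAt (fun z => Real.log (1 + 2 * z + 2 * z ^ 2) - (2 * z - 2 / 5 * z ^ 2))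
      (4 / 5 * y * (1 - y) * (1 - 2 * y) / (1 + 2 * y + 2 * y ^ 2)) y := by
  have hpos := one_add_two_mul_add_two_mul_sq_pos y
  have hlog := ((((hasDerivAt_id y).const_mul 2).const_add 1).add
    ((hasDerivAt_pow 2 y).const_mul 2)).log hpos.ne'
  refine (hlog.sub (((hasDerivAt_id y).const_mul 2).sub
    ((hasDerivAt_pow 2 y).const_mul (2 / 5)))).congr_deriv ?_
  norm_num
  field_simp
  ring

theorem two_mul_sub_le_log (hz : z ≤ 1 / 2) :
    2 * z - 2 / 5 * z ^ 2 ≤ Real.log (1 + 2 * z + 2 * z ^ 2) := by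
  rcases le_total 0 z with h | h
  · have hmono := le_of_hasDerivAt_nonneg h (fun y _ => hasDerivAt_log_sub_quadratic y)
      fun y hy => div_nonneg (mul_nonneg (mul_nonneg (by linarith [hy.1]) (by linarith [hy.2]))
        (by linarith [hy.2])) (one_add_two_mul_add_two_mul_sq_pos y).le
    norm_num at hmono
    linarith
  · have hmono := le_of_hasDerivAt_nonneg h (fun y _ => (hasDerivAt_log_sub_quadratic y).neg)
      fun y hy => neg_nonneg.2 (div_nonpos_of_nonpos_of_nonneg (mul_nonpos_of_nonpos_of_nonneg
        (mul_nonpos_of_nonpos_of_nonneg (by linarith [hy.2]) (by linarith [hy.2]))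
        (by linarith [hy.2])) (one_add_two_mul_add_two_mul_sq_pos y).le)
    norm_num at hmono
    linarith

end Calculus

section Saddle

theorem arg_eq_arctan_of_re_pos {x : ℂ} (hx : 0 < x.re) : x.arg = Real.arctan (x.im / x.re) := by
  have h := abs_lt.1 (Complex.abs_arg_lt_pi_div_two_iff.2 (Or.inl hx))
  rw [← Complex.tan_arg, Real.arctan_tan h.1 h.2]

theorem arg_le_neg_pi_div_four {x : ℂ} (him : x.im < 0) (h : x.re ≤ -x.im) :
    x.arg ≤ -(π / 4) := by
  rcases le_or_gt x.re 0 with hre | hre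
  · have : ¬ -(π / 2) < x.arg := by
      rw [Complex.neg_pi_div_two_lt_arg_iff]
      push Not
      exact ⟨hre, him⟩
    linarith [Real.pi_pos]
  · rw [arg_eq_arctan_of_re_pos hre, ← Real.arctan_one, ← Real.arctan_neg]
    refine Real.arctan_mono ?_
    rw [div_le_iff₀ hre]
    linarith

variable {a c v : ℝ}

theorem arg_diagonal (hc : 0 < c) (hv : -c < v) :
    (diagonal c v).arg = Real.arctan (v / c / (1 + v / c)) := by
  have hcv : 0 < c + v := by linarith
  rw [arg_eq_arctan_of_re_pos (by rwa [diagonal_re]), diagonal_re, diagonal_im,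
    one_add_div hc.ne', div_div_div_cancel_right₀ hc.ne']

theorem norm_diagonal (hc : 0 < c) (v : ℝ) :
    ‖diagonal c v‖ = c * √(1 + 2 * (v / c) + 2 * (v / c) ^ 2) := by
  rw [← Real.sqrt_sq (norm_nonneg _), norm_diagonal_sq]
  nth_rewrite 2 [← Real.sqrt_sq hc.le]
  rw [← Real.sqrt_mul (sq_nonneg c)]
  congr 1
  field_simp
  ring

theorem inv_norm_diagonal_le_exp (hc : 0 < c) (hv : v ≤ c / 2) :
    1 / ‖diagonal c v‖ ≤ 1 / c * Real.exp (-(v / c) + 1 / 5 * (v / c) ^ 2) := by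
  have hlog := two_mul_sub_le_log (z := v / c) (by rw [div_le_iff₀ hc]; linarith)
  have hsqrt : Real.exp (v / c - 1 / 5 * (v / c) ^ 2) ≤ √(1 + 2 * (v / c) + 2 * (v / c) ^ 2) := by
    refine Real.le_sqrt_of_sq_le ?_
    rw [← Real.exp_nat_mul, ← Real.le_log_iff_exp_le (one_add_two_mul_add_two_mul_sq_pos _)]
    push_cast
    linarith
  rw [norm_diagonal hc, one_div, mul_inv, ← one_div c,
    show -(v / c) + 1 / 5 * (v / c) ^ 2 = -(v / c - 1 / 5 * (v / c) ^ 2) by ring, Real.exp_neg]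
  gcongr

/-- The phase of the integrand of `riemannAux`: for `x = diagonal c v` and `s = 2πa²i`, the modulus
of `x ^ (-s) * exp (πix²)` is `exp (2π * saddlePhase a c v)`. The saddle point is near `x = a`. -/
noncomputable def saddlePhase (a c v : ℝ) : ℝ := a ^ 2 * (diagonal c v).arg - c * v - v ^ 2

theorem saddlePhase_le_quadratic (hc : 0 < c) (hv : -(c / 2) ≤ v) (hv' : v ≤ 3 / 8 * c) :
    saddlePhase a c v ≤ (a ^ 2 - c ^ 2) / c * v - (1 + 3 / 4 * (a / c) ^ 2) * v ^ 2 := by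
  have harctan := arctan_div_one_add_le_quadratic (z := v / c)
    (by rw [le_div_iff₀ hc]; linarith) (by rwa [div_le_iff₀ hc])
  calc saddlePhase a c v ≤ a ^ 2 * (v / c - 3 / 4 * (v / c) ^ 2) - c * v - v ^ 2 := by
        rw [saddlePhase, arg_diagonal hc (by linarith)]
        gcongr
    _ = (a ^ 2 - c ^ 2) / c * v - (1 + 3 / 4 * (a / c) ^ 2) * v ^ 2 := by
        field_simp
        ring

theorem saddlePhase_le_linear (hc : 0 < c) (hv : 3 / 8 * c ≤ v) :
    saddlePhase a c v ≤ -(33 / 64 * c ^ 2 - 0.2696 * a ^ 2) -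
      (7 / 4 * c ^ 2 - a ^ 2 / 2) / c * (v - 3 / 8 * c) := by
  have harctan := arctan_div_one_add_le_linear (z := v / c) (by rwa [le_div_iff₀ hc])
  calc saddlePhase a c v ≤ a ^ 2 * (0.2696 + (v / c - 3 / 8) / 2) - c * v - v ^ 2 := by
        rw [saddlePhase, arg_diagonal hc (by linarith)]
        gcongr
    _ = -(33 / 64 * c ^ 2 - 0.2696 * a ^ 2) -
          (7 / 4 * c ^ 2 - a ^ 2 / 2) / c * (v - 3 / 8 * c) - (v - 3 / 8 * c) ^ 2 := by
        field_simp
        ring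
    _ ≤ _ := sub_le_self _ (sq_nonneg _)

theorem saddlePhase_le_of_le_neg_half (hc : 0 < c) (hv : v ≤ -(c / 2)) :
    saddlePhase a c v ≤ -(π / 4 * a ^ 2 - c ^ 2 / 4) - (v + c / 2) ^ 2 := by
  have harg := arg_le_neg_pi_div_four (x := diagonal c v) (by rw [diagonal_im]; linarith)
    (by rw [diagonal_re, diagonal_im]; linarith)
  rw [saddlePhase]
  nlinarith [mul_le_mul_of_nonneg_left harg (sq_nonneg a)]

/-- Up to a power of `x = diagonal c v`, twice the modulus of the integrand of `riemannAux` at `x`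
when the imaginary part of `s` is `2πa²`. -/
noncomputable def saddleDensity (a c v : ℝ) : ℝ :=
  Real.exp (2 * π * saddlePhase a c v) / ‖Complex.sin (π * diagonal c v)‖

theorem saddleDensity_nonneg (a c v : ℝ) : 0 ≤ saddleDensity a c v := by
  unfold saddleDensity
  positivity

theorem saddleDensity_le_exp (hsin : 1 ≤ ‖Complex.sin (π * diagonal c v)‖) :
    saddleDensity a c v ≤ Real.exp (2 * π * saddlePhase a c v) :=
  div_le_self (Real.exp_pos _).le hsin

theorem saddleDensity_le_exp_div_two (hv : 1 / 2 ≤ |v|) :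
    saddleDensity a c v ≤ Real.exp (2 * π * saddlePhase a c v) / 2 :=
  div_le_div_of_nonneg_left (Real.exp_pos _).le two_pos
    (two_le_norm_sin_pi_mul (by rwa [diagonal_im]))

theorem norm_riemannAuxIntegrand_diagonal {s : ℂ} (hc : 0 < c) (hs : s.im = 2 * π * a ^ 2) (v : ℝ) :
    ‖riemannAuxIntegrand s (diagonal c v)‖ =
      ‖diagonal c v‖ ^ (-s.re) * saddleDensity a c v / 2 := by
  rw [norm_riemannAuxIntegrand s (diagonal_ne_zero hc v), diagonal_re, diagonal_im, hs,
    saddleDensity, saddlePhase]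
  ring_nf

theorem integrable_rpow_mul_saddleDensity_add_half {σ : ℝ} (hσ : 0 ≤ σ) (a : ℝ) (m : ℕ) :
    Integrable fun v => ‖diagonal (m + 1 / 2) v‖ ^ (-σ) * saddleDensity a (m + 1 / 2) v := by
  have hint := (integrable_riemannAuxIntegrand_diagonal_add_half
    (s := ⟨σ, 2 * π * a ^ 2⟩) hσ m).norm.mul_const 2
  refine hint.congr (Eventually.of_forall fun v => ?_)
  simp only [norm_riemannAuxIntegrand_diagonal (by positivity : (0 : ℝ) < m + 1 / 2)
    (rfl : (⟨σ, 2 * π * a ^ 2⟩ : ℂ).im = _)]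
  ring

end Saddle

theorem integrableOn_Ioi_exp_neg_mul_sub {k : ℝ} (hk : 0 < k) (b : ℝ) :
    IntegrableOn (fun v => Real.exp (-k * (v - b))) (Set.Ioi b) := by
  refine ((integrableOn_exp_mul_Ioi (neg_lt_zero.2 hk) b).const_mul (Real.exp (k * b))).congr
    (Eventually.of_forall fun v => ?_)
  simp only [← Real.exp_add]
  ring_nf

theorem integral_Ioi_exp_neg_mul_sub {k : ℝ} (hk : 0 < k) (b : ℝ) :
    ∫ v in Set.Ioi b, Real.exp (-k * (v - b)) = 1 / k := by
  have h : ∀ v : ℝ, Real.exp (-k * (v - b)) = Real.exp (k * b) * Real.exp (-k * v) := fun v => by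
    rw [← Real.exp_add]
    ring_nf
  simp_rw [h]
  rw [integral_const_mul, integral_exp_mul_Ioi (neg_lt_zero.2 hk), neg_div_neg_eq, ← mul_div_assoc,
    ← Real.exp_add, neg_mul, add_neg_cancel, Real.exp_zero]

theorem integral_Iic_exp_neg_mul_sub_sq (k b : ℝ) :
    ∫ v in Set.Iic b, Real.exp (-k * (v - b) ^ 2) = √(π / k) / 2 := by
  have hreflect := (Measure.measurePreserving_sub_left volume b).setIntegral_preimage_emb
    (MeasurableEquiv.subLeft b).measurableEmbedding (fun v : ℝ => Real.exp (-k * v ^ 2)) (Set.Ici 0)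
  rw [Set.preimage_const_sub_Ici, sub_zero, integral_Ici_eq_integral_Ioi, integral_gaussian_Ioi]
    at hreflect
  simp_rw [← hreflect, ← sq_abs (b - _), abs_sub_comm b, sq_abs]

section SaddleIntegral

variable {a c : ℝ} {w : ℝ → ℝ}

theorem integral_Iic_mul_saddleDensity_le {K : ℝ} (hc : 1 ≤ c) (hw : ∀ v, 0 ≤ w v)
    (hK : ∀ v ≤ -(c / 2), w v ≤ K) :
    ∫ v in Set.Iic (-(c / 2)), w v * saddleDensity a c v ≤
      K / (4 * √2) * Real.exp (-(2 * π * (π / 4 * a ^ 2 - c ^ 2 / 4))) := by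
  set E := Real.exp (-(2 * π * (π / 4 * a ^ 2 - c ^ 2 / 4)))
  have hbound : ∀ v ∈ Set.Iic (-(c / 2)), w v * saddleDensity a c v ≤
      K * (E / 2) * Real.exp (-(2 * π) * (v - -(c / 2)) ^ 2) := fun v hv => by
    have hv' : 1 / 2 ≤ |v| := by linarith [neg_abs_le v, Set.mem_Iic.1 hv]
    have hK0 : 0 ≤ K := (hw v).trans (hK v hv)
    rw [mul_assoc, div_mul_eq_mul_div, ← Real.exp_add]
    refine mul_le_mul (hK v hv) ((saddleDensity_le_exp_div_two hv').trans ?_)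
      (saddleDensity_nonneg a c v) hK0
    gcongr
    linarith [mul_le_mul_of_nonneg_left (saddlePhase_le_of_le_neg_half (a := a)
      (by linarith) (Set.mem_Iic.1 hv)) Real.two_pi_pos.le]
  calc ∫ v in Set.Iic (-(c / 2)), w v * saddleDensity a c v
      ≤ ∫ v in Set.Iic (-(c / 2)), K * (E / 2) * Real.exp (-(2 * π) * (v - -(c / 2)) ^ 2) :=
        integral_mono_of_nonneg
          (Eventually.of_forall fun v => mul_nonneg (hw v) (saddleDensity_nonneg a c v))
          (((integrable_exp_neg_mul_sq Real.two_pi_pos).comp_sub_right _).integrableOn.const_mul _)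
          (ae_restrict_of_forall_mem measurableSet_Iic hbound)
    _ = K / (4 * √2) * E := by
        rw [integral_const_mul, integral_Iic_exp_neg_mul_sub_sq,
          show π / (2 * π) = 2⁻¹ by field_simp, Real.sqrt_inv]
        field_simp
        norm_num

theorem integral_Ioi_mul_saddleDensity_le (hc : 4 / 3 ≤ c) (hac : a ^ 2 < 7 / 2 * c ^ 2)
    (hw : ∀ v, 0 ≤ w v) (hw1 : ∀ v, 3 / 8 * c < v → w v ≤ 1) :
    ∫ v in Set.Ioi (3 / 8 * c), w v * saddleDensity a c v ≤
      Real.exp (-(2 * π * (33 / 64 * c ^ 2 - 0.2696 * a ^ 2))) /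
        (2 * (2 * π * ((7 / 4 * c ^ 2 - a ^ 2 / 2) / c))) := by
  set E := Real.exp (-(2 * π * (33 / 64 * c ^ 2 - 0.2696 * a ^ 2)))
  set k := 2 * π * ((7 / 4 * c ^ 2 - a ^ 2 / 2) / c) with hk
  have hk0 : 0 < k := mul_pos Real.two_pi_pos (div_pos (by linarith) (by linarith))
  have hbound : ∀ v ∈ Set.Ioi (3 / 8 * c), w v * saddleDensity a c v ≤
      E / 2 * Real.exp (-k * (v - 3 / 8 * c)) := fun v hv => by
    have hv' : 1 / 2 ≤ |v| := by linarith [le_abs_self v, Set.mem_Ioi.1 hv]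
    refine (mul_le_of_le_one_left (saddleDensity_nonneg a c v) (hw1 v hv)).trans
      ((saddleDensity_le_exp_div_two hv').trans ?_)
    rw [div_mul_eq_mul_div, ← Real.exp_add, hk]
    gcongr
    linarith [mul_le_mul_of_nonneg_left (saddlePhase_le_linear (a := a)
      (by linarith) (Set.mem_Ioi.1 hv).le) Real.two_pi_pos.le]
  calc ∫ v in Set.Ioi (3 / 8 * c), w v * saddleDensity a c v
      ≤ ∫ v in Set.Ioi (3 / 8 * c), E / 2 * Real.exp (-k * (v - 3 / 8 * c)) :=
        integral_mono_of_nonneg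
          (Eventually.of_forall fun v => mul_nonneg (hw v) (saddleDensity_nonneg a c v))
          ((integrableOn_Ioi_exp_neg_mul_sub hk0 _).const_mul _)
          (ae_restrict_of_forall_mem measurableSet_Ioi hbound)
    _ = E / (2 * k) := by
        rw [integral_const_mul, integral_Ioi_exp_neg_mul_sub hk0]
        field_simp

theorem integral_Ioc_mul_saddleDensity_le {R p q : ℝ} (hR : 0 ≤ R) (hq : 0 < q)
    (hw : ∀ v, 0 ≤ w v) (hsin : ∀ v, 1 ≤ ‖Complex.sin (π * diagonal c v)‖)
    (hgauss : ∀ v ∈ Set.Ioc (-(c / 2)) (3 / 8 * c), w v * Real.exp (2 * π * saddlePhase a c v) ≤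
      R * Real.exp (2 * π * (p * v - q * v ^ 2))) :
    ∫ v in Set.Ioc (-(c / 2)) (3 / 8 * c), w v * saddleDensity a c v ≤
      R * (Real.exp (π * p ^ 2 / (2 * q)) / √(2 * q)) := by
  have hint := (integrable_exp_two_pi_mul_quadratic p hq).const_mul R
  calc ∫ v in Set.Ioc (-(c / 2)) (3 / 8 * c), w v * saddleDensity a c v
      ≤ ∫ v in Set.Ioc (-(c / 2)) (3 / 8 * c), R * Real.exp (2 * π * (p * v - q * v ^ 2)) :=
        integral_mono_of_nonneg
          (Eventually.of_forall fun v => mul_nonneg (hw v) (saddleDensity_nonneg a c v))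
          hint.integrableOn (ae_restrict_of_forall_mem measurableSet_Ioc fun v hv =>
            (mul_le_mul_of_nonneg_left (saddleDensity_le_exp (hsin v)) (hw v)).trans (hgauss v hv))
    _ ≤ ∫ v, R * Real.exp (2 * π * (p * v - q * v ^ 2)) :=
        setIntegral_le_integral hint (Eventually.of_forall fun v => by positivity)
    _ = R * (Real.exp (π * p ^ 2 / (2 * q)) / √(2 * q)) := by
        rw [integral_const_mul, integral_exp_two_pi_mul_quadratic p hq]

end SaddleIntegral

section Numerics

theorem mul_exp_div_sqrt_le {R p q y : ℝ} (hq : 0 < q) (hy : 0 ≤ y)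
    (h : R ^ 2 * (Real.exp (π * p ^ 2 / q) / (2 * q)) ≤ y ^ 2) :
    R * (Real.exp (π * p ^ 2 / (2 * q)) / √(2 * q)) ≤ y := by
  refine le_of_pow_le_pow_left₀ two_ne_zero hy (le_trans (le_of_eq ?_) h)
  rw [mul_pow, div_pow, Real.sq_sqrt (by positivity), ← Real.exp_nat_mul]
  push_cast
  field_simp

theorem exp_one_point_eight_one_le : Real.exp 1.8109 ≤ 6.117 := by
  have hhalf : Real.exp (1.8109 / 2) ≤ 2.47325 := by
    refine (Real.exp_bound' (by norm_num) (by norm_num) (n := 10) (by norm_num)).trans ?_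
    norm_num [Finset.sum_range_succ, Nat.factorial]
  calc Real.exp 1.8109 = Real.exp (1.8109 / 2) ^ 2 := by rw [← Real.exp_nat_mul]; norm_num
    _ ≤ 2.47325 ^ 2 := by gcongr
    _ ≤ 6.117 := by norm_num

theorem exp_one_point_eight_four_le : Real.exp 1.841 ≤ 6.31 := by
  have hsmall : Real.exp 0.0301 ≤ 1.0306 := by
    refine (Real.exp_bound' (by norm_num) (by norm_num) (n := 4) (by norm_num)).trans ?_
    norm_num [Finset.sum_range_succ, Nat.factorial]
  calc Real.exp 1.841 = Real.exp 1.8109 * Real.exp 0.0301 := by rw [← Real.exp_add]; norm_num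
    _ ≤ 6.117 * 1.0306 := by gcongr; exact exp_one_point_eight_one_le
    _ ≤ 6.31 := by norm_num

theorem exp_mul_quadratic_le {x y : ℝ} (hy : 0 ≤ y) (hx : x ≤ 1.8109 - y) :
    Real.exp x * (1 + y + y ^ 2 / 2) ≤ 6.117 :=
  calc Real.exp x * (1 + y + y ^ 2 / 2) ≤ Real.exp (1.8109 - y) * Real.exp y := by
        gcongr
        exact Real.quadratic_le_exp_of_nonneg hy
    _ = Real.exp 1.8109 := by rw [← Real.exp_add, sub_add_cancel]
    _ ≤ 6.117 := exp_one_point_eight_one_le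

variable {c δ p q : ℝ}

theorem gaussian_le_of_nonneg (hδ : 0 ≤ δ) (hp : p ^ 2 ≤ 1 / 4 * (2 + δ) ^ 2) :
    Real.exp (π * p ^ 2 / (1 + 3 / 4 * (1 + δ) ^ 2)) / (2 * (1 + 3 / 4 * (1 + δ) ^ 2)) ≤ 1.85 := by
  have hquot : p ^ 2 / (1 + 3 / 4 * (1 + δ) ^ 2) ≤ 0.5858 := by
    rw [div_le_iff₀ (by positivity)]
    nlinarith [sq_nonneg (δ - 0.32)]
  have hexp : Real.exp (π * p ^ 2 / (1 + 3 / 4 * (1 + δ) ^ 2)) ≤ 6.31 := by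
    refine (Real.exp_le_exp.2 ?_).trans exp_one_point_eight_four_le
    rw [mul_div_assoc]
    nlinarith [Real.pi_pos, Real.pi_lt_d4]
  rw [div_le_iff₀ (by positivity)]
  nlinarith

theorem gaussian_le_of_nonpos (hδ : δ ≤ 0) (hδ' : -0.2 ≤ δ) (hp : p ^ 2 ≤ 1 / 4 * (2 + δ) ^ 2) :
    Real.exp (π * p ^ 2 / (1 + 3 / 4 * (1 + δ) ^ 2)) / (2 * (1 + 3 / 4 * (1 + δ) ^ 2)) ≤
      1.9656 := by
  have hquot : p ^ 2 / (1 + 3 / 4 * (1 + δ) ^ 2) ≤ 4 / 7 + 0.08 * δ := by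
    rw [div_le_iff₀ (by positivity)]
    nlinarith [mul_nonneg (sq_nonneg δ) (by linarith : 0 ≤ δ + 0.2)]
  set E := Real.exp (π * p ^ 2 / (1 + 3 / 4 * (1 + δ) ^ 2))
  have hquad : E * (1 + (0.0156 - 0.25 * δ) + (0.0156 - 0.25 * δ) ^ 2 / 2) ≤ 6.117 := by
    refine exp_mul_quadratic_le (by linarith) ?_
    rw [mul_div_assoc]
    nlinarith [Real.pi_pos, Real.pi_lt_d4, Real.pi_gt_d4]
  have hlin : E * (1.0156 - 0.25 * δ) ≤ 6.117 := by
    nlinarith [sq_nonneg (0.0156 - 0.25 * δ), Real.exp_pos (π * p ^ 2 / (1 + 3 / 4 * (1 + δ) ^ 2))]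
  have hpoly : 6.117 ≤ 1.9656 * (2 * (1 + 3 / 4 * (1 + δ) ^ 2)) * (1.0156 - 0.25 * δ) := by
    nlinarith [mul_nonneg (neg_nonneg.2 hδ) (by linarith : 0 ≤ δ + 0.2),
      pow_nonneg (neg_nonneg.2 hδ) 3]
  rw [div_le_iff₀ (by positivity)]
  exact le_of_mul_le_mul_right (hlin.trans hpoly) (by linarith)

theorem sq_mul_gaussian_le_of_nonneg (hδ : 0 ≤ δ) (hδ' : δ ≤ 1 / 3)
    (hp : p ^ 2 ≤ (1 + 0.182 * δ) ^ 2) (hq : 1.7358 + 1.5 * δ + 0.75 * δ ^ 2 ≤ q) :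
    (1 + δ) ^ 2 * (Real.exp (π * p ^ 2 / q) / (2 * q)) ≤ 1.85 := by
  have hq0 : 0 < q := lt_of_lt_of_le (by positivity) hq
  have hquot : p ^ 2 / q ≤ 0.5764 - 0.27 * δ := by
    rw [div_le_iff₀ hq0]
    refine hp.trans (le_trans ?_ (mul_le_mul_of_nonneg_left hq (by linarith)))
    nlinarith [mul_nonneg (mul_nonneg hδ (sub_nonneg.2 hδ')) hδ]
  have hx : π * p ^ 2 / q ≤ 1.8109 - 0.848 * δ := by
    rw [mul_div_assoc]
    calc π * (p ^ 2 / q) ≤ π * (0.5764 - 0.27 * δ) := by gcongr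
      _ ≤ 1.8109 - 0.848 * δ := by nlinarith [Real.pi_lt_d4, Real.pi_gt_d4]
  have hpoly : (1 + δ) ^ 2 * 6.117 ≤ 1.85 * (2 * (1.7358 + 1.5 * δ + 0.75 * δ ^ 2)) *
      (1 + 0.848 * δ + (0.848 * δ) ^ 2 / 2) := by
    nlinarith only [pow_nonneg hδ 3, pow_nonneg hδ 4, sq_nonneg (δ - 0.1685)]
  rw [← mul_div_assoc, div_le_iff₀ (by positivity)]
  refine le_of_mul_le_mul_right ?_ (by positivity : 0 < 1 + 0.848 * δ + (0.848 * δ) ^ 2 / 2)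
  rw [mul_assoc ((1 + δ) ^ 2)]
  calc (1 + δ) ^ 2 * (Real.exp (π * p ^ 2 / q) * (1 + 0.848 * δ + (0.848 * δ) ^ 2 / 2))
      ≤ (1 + δ) ^ 2 * 6.117 := by
        gcongr
        exact exp_mul_quadratic_le (by positivity) hx
    _ ≤ _ := hpoly
    _ ≤ _ := by gcongr

theorem sq_mul_gaussian_le_of_nonpos (hδ : δ ≤ 0) (hδ' : -0.2 ≤ δ)
    (hp : p ^ 2 ≤ 1) (hq : 1.7358 + 1.5 * δ + 0.75 * δ ^ 2 ≤ q) :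
    (1 + δ) ^ 2 * (Real.exp (π * p ^ 2 / q) / (2 * q)) ≤ 1.9656 := by
  have hq0 : 0 < q := by nlinarith only [sq_nonneg δ, hq, hδ']
  obtain ⟨e, rfl⟩ : ∃ e, δ = -e := ⟨-δ, (neg_neg δ).symm⟩
  have he : 0 ≤ e := neg_nonpos.1 hδ
  have he' : 0 ≤ e * (0.2 - e) := mul_nonneg he (by linarith)
  have hquot : p ^ 2 / q ≤ 0.5763 + 0.531 * e := by
    rw [div_le_iff₀ hq0]
    refine hp.trans (le_trans ?_ (mul_le_mul_of_nonneg_left hq (by positivity)))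
    nlinarith only [mul_nonneg he' he, he', he, hδ']
  have hsq : (1 + -e) ^ 2 ≤ Real.exp (2 * -e) := by
    rw [two_mul, Real.exp_add, ← pow_two]
    exact pow_le_pow_left₀ (by linarith) (by linarith [Real.add_one_le_exp (-e)]) 2
  have hx : 2 * -e + π * p ^ 2 / q ≤ 1.8109 - 0.331 * e := by
    rw [mul_div_assoc]
    calc 2 * -e + π * (p ^ 2 / q) ≤ 2 * -e + π * (0.5763 + 0.531 * e) := by gcongr
      _ ≤ 1.8109 - 0.331 * e := by nlinarith only [Real.pi_lt_d4, Real.pi_gt_d4, he, hδ']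
  have hquad := exp_mul_quadratic_le (by positivity) hx
  rw [Real.exp_add] at hquad
  have hpoly : 6.117 ≤ 1.9656 * (2 * (1.7358 + 1.5 * -e + 0.75 * (-e) ^ 2)) *
      (1 + 0.331 * e + (0.331 * e) ^ 2 / 2) := by
    nlinarith only [mul_nonneg he' he, he', he, hδ', pow_nonneg he 4]
  rw [← mul_div_assoc, div_le_iff₀ (by positivity)]
  refine le_of_mul_le_mul_right ?_ (by positivity : 0 < 1 + 0.331 * e + (0.331 * e) ^ 2 / 2)
  calc _ ≤ Real.exp (2 * -e) * Real.exp (π * p ^ 2 / q) *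
        (1 + 0.331 * e + (0.331 * e) ^ 2 / 2) := by gcongr
    _ ≤ 6.117 := hquad
    _ ≤ _ := hpoly
    _ ≤ _ := by gcongr

theorem quadratic_le_sub_inv_mul_sq (hc : 3 / 2 ≤ c) (δ : ℝ) :
    1.7358 + 1.5 * δ + 0.75 * δ ^ 2 ≤
      1 + 3 / 4 * (1 + δ) ^ 2 - 1 / (10 * π * c ^ 2) := by
  have hsmall : 1 / (10 * π * c ^ 2) ≤ 0.0142 :=
    calc 1 / (10 * π * c ^ 2) ≤ 1 / (10 * 3.1415 * (3 / 2) ^ 2) := by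
          gcongr
          exact Real.pi_gt_d4.le
      _ ≤ 0.0142 := by norm_num
  linarith

theorem mul_sub_inv_sq_le_of_nonneg (hc : 3 / 2 ≤ c) (hδ : 0 ≤ δ) (hcδ : c * δ ≤ 1 / 2) :
    (c * δ * (2 + δ) - 1 / (2 * π * c)) ^ 2 ≤ (1 + 0.182 * δ) ^ 2 := by
  have : 0 < c := by linarith
  have hlower : 0.318 * δ ≤ 1 / (2 * π * c) := by
    rw [le_div_iff₀ (by positivity)]
    nlinarith [Real.pi_lt_d4, Real.pi_pos]
  have hupper : 1 / (2 * π * c) ≤ 1 := by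
    rw [div_le_one (by positivity)]
    nlinarith [Real.pi_gt_d4]
  refine sq_le_sq' ?_ ?_
  · have : 0 ≤ c * δ * (2 + δ) := by positivity
    linarith
  · nlinarith only [hlower, hcδ, hδ]

theorem mul_sub_inv_sq_le_one_of_nonpos (hc : 3 / 2 ≤ c) (hδ : δ ≤ 0) (hδ' : -2 ≤ δ)
    (hcδ : -(1 / 2) ≤ c * δ) : (c * δ * (2 + δ) - 1 / (2 * π * c)) ^ 2 ≤ 1 := by
  have hc0 : 0 < c := by linarith
  have hquarter : 1 / (2 * π * c) ≤ 1 / (4 * c) := by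
    gcongr
    linarith [Real.pi_gt_three]
  have hnonneg : 0 < 1 / (2 * π * c) := by positivity
  rw [sq_le_one_iff_abs_le_one, abs_le]
  constructor
  · have hfactor : 0 ≤ (1 + 2 * (c * δ)) * (1 - (1 / 2 - c * δ) / (2 * c)) := by
      refine mul_nonneg (by linarith) ?_
      rw [sub_nonneg, div_le_one (by positivity)]
      linarith
    have hexpand : (1 + 2 * (c * δ)) * (1 - (1 / 2 - c * δ) / (2 * c)) =
        1 + c * δ * (2 + δ) - 1 / (4 * c) := by
      field_simp
      ring
    linarith
  · have : c * δ * (2 + δ) ≤ 0 := mul_nonpos_of_nonpos_of_nonneg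
      (mul_nonpos_of_nonneg_of_nonpos hc0.le hδ) (by linarith)
    linarith

variable {a : ℝ}

theorem left_tail_le (hc : 3 / 2 ≤ c) (hac : 4 / 5 * c ≤ a) :
    4 / 3 * √2 / (4 * √2) * Real.exp (-(2 * π * (π / 4 * a ^ 2 - c ^ 2 / 4))) ≤ 0.01 := by
  have harg : 2 * 3.1415 * ((3.1415 / 4 * (4 / 5) ^ 2 - 1 / 4) * (3 / 2) ^ 2) ≤
      2 * π * (π / 4 * a ^ 2 - c ^ 2 / 4) :=
    calc 2 * 3.1415 * ((3.1415 / 4 * (4 / 5) ^ 2 - 1 / 4) * (3 / 2) ^ 2)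
        ≤ 2 * π * ((π / 4 * (4 / 5) ^ 2 - 1 / 4) * c ^ 2) := by
          have hπ := Real.pi_gt_d4.le
          have : (0 : ℝ) ≤ π / 4 * (4 / 5) ^ 2 - 1 / 4 := by linarith
          gcongr
      _ = 2 * π * (π / 4 * (4 / 5 * c) ^ 2 - c ^ 2 / 4) := by ring
      _ ≤ 2 * π * (π / 4 * a ^ 2 - c ^ 2 / 4) := by gcongr
  have hexp : 34 ≤ Real.exp (2 * π * (π / 4 * a ^ 2 - c ^ 2 / 4)) := by
    refine le_trans ?_ (Real.exp_le_exp.2 harg)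
    refine le_trans ?_ (Real.sum_le_exp_of_nonneg (by norm_num) 9)
    norm_num [Finset.sum_range_succ, Nat.factorial]
  calc _ ≤ 4 / 3 * √2 / (4 * √2) * 34⁻¹ := by rw [Real.exp_neg]; gcongr
    _ ≤ 0.01 := by
      rw [mul_div_mul_right _ _ (by positivity)]
      norm_num

theorem right_tail_le {ρ y : ℝ} (hc : 3 / 2 ≤ c) (hac : a ^ 2 ≤ ρ * c ^ 2)
    (hρ : 0.2696 * ρ ≤ 33 / 64) (hy0 : 0 < y)
    (hy : y ≤ Real.exp (2 * 3.1415 * ((33 / 64 - 0.2696 * ρ) * (9 / 4)))) :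
    Real.exp (-(2 * π * (33 / 64 * c ^ 2 - 0.2696 * a ^ 2))) /
        (2 * (2 * π * ((7 / 4 * c ^ 2 - a ^ 2 / 2) / c))) ≤
      1 / (y * (2 * (2 * 3.1415 * ((7 / 4 - ρ / 2) * (3 / 2))))) := by
  have hc0 : 0 < c := by linarith
  have hπ := Real.pi_gt_d4.le
  have hc2 : 9 / 4 ≤ c ^ 2 := by nlinarith
  have : 0 ≤ 33 / 64 - 0.2696 * ρ := by linarith
  have hslope_pos : 0 < 7 / 4 - ρ / 2 := by linarith
  have hphase : (33 / 64 - 0.2696 * ρ) * c ^ 2 ≤ 33 / 64 * c ^ 2 - 0.2696 * a ^ 2 := by linarith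
  have hslope : (7 / 4 - ρ / 2) * c ≤ (7 / 4 * c ^ 2 - a ^ 2 / 2) / c := by
    rw [le_div_iff₀ hc0]
    linarith
  rw [Real.exp_neg, ← one_div, div_div]
  gcongr
  · refine hy.trans (Real.exp_le_exp.2 ?_)
    calc _ ≤ 2 * π * ((33 / 64 - 0.2696 * ρ) * c ^ 2) := by gcongr
      _ ≤ _ := by gcongr
  · calc (7 / 4 - ρ / 2) * (3 / 2) ≤ (7 / 4 - ρ / 2) * c := by gcongr
      _ ≤ _ := hslope

theorem right_tail_le_of_le_four_thirds (hc : 3 / 2 ≤ c) (ha : 0 ≤ a) (hac : a ≤ 4 / 3 * c) :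
    Real.exp (-(2 * π * (33 / 64 * c ^ 2 - 0.2696 * a ^ 2))) /
      (2 * (2 * π * ((7 / 4 * c ^ 2 - a ^ 2 / 2) / c))) ≤ 0.0375 := by
  have hac2 : a ^ 2 ≤ 16 / 9 * c ^ 2 := (pow_le_pow_left₀ ha hac 2).trans (by linarith)
  refine (right_tail_le (y := 1.668) hc hac2 (by norm_num) (by norm_num) ?_).trans (by norm_num)
  refine le_trans ?_ (Real.sum_le_exp_of_nonneg (by norm_num) 4)
  norm_num [Finset.sum_range_succ, Nat.factorial]

theorem right_tail_le_of_le (hc : 3 / 2 ≤ c) (ha : 0 ≤ a) (hac : a ≤ c) :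
    Real.exp (-(2 * π * (33 / 64 * c ^ 2 - 0.2696 * a ^ 2))) /
      (2 * (2 * π * ((7 / 4 * c ^ 2 - a ^ 2 / 2) / c))) ≤ 0.002 := by
  have hac2 : a ^ 2 ≤ 1 * c ^ 2 := by
    rw [one_mul]
    gcongr
  refine (right_tail_le (y := 27) hc hac2 (by norm_num) (by norm_num) ?_).trans (by norm_num)
  refine le_trans ?_ (Real.sum_le_exp_of_nonneg (by norm_num) 7)
  norm_num [Finset.sum_range_succ, Nat.factorial]

end Numerics

section SaddleBound

variable {a c δ v : ℝ}

theorem integral_mul_saddleDensity_le_sqrt_two {w : ℝ → ℝ} {R p q : ℝ} (hc : 3 / 2 ≤ c)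
    (hca : 4 / 5 * c ≤ a) (hac : a ≤ 4 / 3 * c)
    (hsin : ∀ v, 1 ≤ ‖Complex.sin (π * diagonal c v)‖)
    (hint : Integrable fun v => w v * saddleDensity a c v) (hw : ∀ v, 0 ≤ w v)
    (hleft : ∀ v ≤ -(c / 2), w v ≤ 4 / 3 * √2) (hright : ∀ v, 3 / 8 * c < v → w v ≤ 1)
    (hR : 0 ≤ R) (hq : 0 < q)
    (hgauss : ∀ v ∈ Set.Ioc (-(c / 2)) (3 / 8 * c), w v * Real.exp (2 * π * saddlePhase a c v) ≤
      R * Real.exp (2 * π * (p * v - q * v ^ 2)))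
    (hge : c ≤ a → R ^ 2 * (Real.exp (π * p ^ 2 / q) / (2 * q)) ≤ 1.85)
    (hle : a ≤ c → R ^ 2 * (Real.exp (π * p ^ 2 / q) / (2 * q)) ≤ 1.9656) :
    ∫ v, w v * saddleDensity a c v ≤ √2 := by
  have ha : 0 ≤ a := by linarith
  have hsplit : ∫ v, w v * saddleDensity a c v =
      (∫ v in Set.Iic (-(c / 2)), w v * saddleDensity a c v) +
      (∫ v in Set.Ioc (-(c / 2)) (3 / 8 * c), w v * saddleDensity a c v) +
      ∫ v in Set.Ioi (3 / 8 * c), w v * saddleDensity a c v := by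
    rw [← intervalIntegral.integral_Iic_add_Ioi hint.integrableOn hint.integrableOn, add_assoc,
      ← setIntegral_union Set.Ioc_disjoint_Ioi_same measurableSet_Ioi hint.integrableOn
        hint.integrableOn, Set.Ioc_union_Ioi_eq_Ioi (by linarith)]
  have hIic := (integral_Iic_mul_saddleDensity_le (a := a) (by linarith) hw hleft).trans
    (left_tail_le hc hca)
  have hIoc := integral_Ioc_mul_saddleDensity_le hR hq hw hsin hgauss
  have hIoi := integral_Ioi_mul_saddleDensity_le (a := a) (by linarith) (by nlinarith) hw hright
  have hsqrt : 1.4142 ≤ √2 := Real.le_sqrt_of_sq_le (by norm_num)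
  rw [hsplit]
  -- The right tail is only small for `a ≤ c`, so for `c ≤ a` the Gaussian part has to leave it more
  -- room below `√2`.
  rcases le_total c a with h | h
  · have hgaussian := mul_exp_div_sqrt_le (y := 1.3602) hq (by norm_num)
      ((hge h).trans (by norm_num))
    linarith [right_tail_le_of_le_four_thirds hc ha hac]
  · have hgaussian := mul_exp_div_sqrt_le (y := 1.40201) hq (by norm_num)
      ((hle h).trans (by norm_num))
    linarith [right_tail_le_of_le hc ha h]

theorem saddlePhase_mul_one_add_le (hc : 0 < c) (hv : -(c / 2) ≤ v) (hv' : v ≤ 3 / 8 * c) :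
    saddlePhase (c * (1 + δ)) c v ≤ c * δ * (2 + δ) * v - (1 + 3 / 4 * (1 + δ) ^ 2) * v ^ 2 := by
  refine (saddlePhase_le_quadratic hc hv hv').trans (le_of_eq ?_)
  field_simp
  ring

theorem inv_norm_mul_exp_saddlePhase_le (hc : 0 < c) (hδ : -1 ≤ δ) (hv : -(c / 2) ≤ v)
    (hv' : v ≤ 3 / 8 * c) :
    c * (1 + δ) / ‖diagonal c v‖ * Real.exp (2 * π * saddlePhase (c * (1 + δ)) c v) ≤
      (1 + δ) * Real.exp (2 * π * ((c * δ * (2 + δ) - 1 / (2 * π * c)) * v -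
        (1 + 3 / 4 * (1 + δ) ^ 2 - 1 / (10 * π * c ^ 2)) * v ^ 2)) := by
  have hδ' : 0 ≤ 1 + δ := by linarith
  rw [div_eq_mul_one_div]
  calc _ ≤ c * (1 + δ) * (1 / c * Real.exp (-(v / c) + 1 / 5 * (v / c) ^ 2)) *
        Real.exp (2 * π * (c * δ * (2 + δ) * v - (1 + 3 / 4 * (1 + δ) ^ 2) * v ^ 2)) := by
        gcongr
        · exact inv_norm_diagonal_le_exp hc (by linarith)
        · exact saddlePhase_mul_one_add_le hc hv hv'
    _ = (1 + δ) * (Real.exp (-(v / c) + 1 / 5 * (v / c) ^ 2) *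
        Real.exp (2 * π * (c * δ * (2 + δ) * v - (1 + 3 / 4 * (1 + δ) ^ 2) * v ^ 2))) := by
        field_simp
    _ = _ := by
        rw [← Real.exp_add]
        congr 2
        field_simp
        ring

variable {m : ℕ}

theorem integrable_saddleDensity (hcm : c = m + 1 / 2) : Integrable (saddleDensity a c) := by
  simpa only [neg_zero, Real.rpow_zero, one_mul, ← hcm] using
    integrable_rpow_mul_saddleDensity_add_half le_rfl a m

theorem integrable_div_norm_mul_saddleDensity (hcm : c = m + 1 / 2) :
    Integrable fun v => a / ‖diagonal c v‖ * saddleDensity a c v := by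
  simpa only [Real.rpow_neg_one, ← hcm, ← mul_assoc, ← div_eq_mul_inv] using
    (integrable_rpow_mul_saddleDensity_add_half zero_le_one a m).const_mul a

theorem integral_saddleDensity_le_sqrt_two (hc : 3 / 2 ≤ c) (hcm : c = m + 1 / 2)
    (hac : |a - c| ≤ 1 / 2) (hca : 4 / 5 * c ≤ a) : ∫ v, saddleDensity a c v ≤ √2 := by
  obtain ⟨δ, rfl⟩ : ∃ δ, a = c * (1 + δ) := ⟨a / c - 1, by field_simp; ring⟩
  obtain ⟨hlow, hup⟩ := abs_le.1 hac
  have hc0 : 0 < c := by linarith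
  have hδ : -0.2 ≤ δ := by nlinarith
  have hp : (c * δ * (2 + δ)) ^ 2 ≤ 1 / 4 * (2 + δ) ^ 2 := by
    have hcδ : (c * δ) ^ 2 ≤ (1 / 2) ^ 2 := sq_le_sq' (by linarith) (by linarith)
    rw [mul_pow]
    gcongr
    linarith
  have hsqrt : 1 ≤ √2 := Real.one_le_sqrt.2 one_le_two
  have hbound := integral_mul_saddleDensity_le_sqrt_two (w := fun _ => 1) (R := 1)
    (p := c * δ * (2 + δ)) (q := 1 + 3 / 4 * (1 + δ) ^ 2) hc hca (by linarith)
    (hcm ▸ one_le_norm_sin_pi_mul_diagonal_add_half m)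
    (by simpa only [one_mul] using integrable_saddleDensity hcm)
    (fun _ => zero_le_one) (fun _ _ => by linarith) (fun _ _ => le_rfl) zero_le_one (by positivity)
    (fun v hv => by
      rw [one_mul, one_mul]
      gcongr
      exact saddlePhase_mul_one_add_le hc0 hv.1.le hv.2)
    (fun h => by
      rw [one_pow, one_mul]
      exact gaussian_le_of_nonneg (by nlinarith) hp)
    (fun h => by
      rw [one_pow, one_mul]
      exact gaussian_le_of_nonpos (by nlinarith) hδ hp)
  simpa only [one_mul] using hbound

theorem integral_div_norm_mul_saddleDensity_le_sqrt_two (hc : 3 / 2 ≤ c) (hcm : c = m + 1 / 2)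
    (hac : |a - c| ≤ 1 / 2) (hca : 4 / 5 * c ≤ a) :
    ∫ v, a / ‖diagonal c v‖ * saddleDensity a c v ≤ √2 := by
  obtain ⟨δ, rfl⟩ : ∃ δ, a = c * (1 + δ) := ⟨a / c - 1, by field_simp; ring⟩
  obtain ⟨hlow, hup⟩ := abs_le.1 hac
  have hc0 : 0 < c := by linarith
  have hδ : -0.2 ≤ δ := by nlinarith
  have hδ' : δ ≤ 1 / 3 := by nlinarith
  have hδ0 : 0 ≤ 1 + δ := by linarith
  have hq := quadratic_le_sub_inv_mul_sq hc δ
  refine integral_mul_saddleDensity_le_sqrt_two (R := 1 + δ)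
    (p := c * δ * (2 + δ) - 1 / (2 * π * c))
    (q := 1 + 3 / 4 * (1 + δ) ^ 2 - 1 / (10 * π * c ^ 2)) hc hca (by linarith)
    (hcm ▸ one_le_norm_sin_pi_mul_diagonal_add_half m)
    (integrable_div_norm_mul_saddleDensity hcm) (fun v => by positivity)
    (fun v _ => ?_) (fun v hv => ?_) hδ0 (by nlinarith) (fun v hv =>
      inv_norm_mul_exp_saddlePhase_le hc0 (by linarith) hv.1.le hv.2)
    (fun h => ?_) (fun h => ?_)
  · calc c * (1 + δ) / ‖diagonal c v‖ ≤ 4 / 3 * c / (c / √2) :=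
          div_le_div₀ (by linarith) (by linarith) (by positivity)
            (div_sqrt_two_le_norm_diagonal c v)
      _ = 4 / 3 * √2 := by field_simp
  · refine div_le_one_of_le₀ ?_ (norm_nonneg _)
    calc c * (1 + δ) ≤ (diagonal c v).re := by rw [diagonal_re]; linarith
      _ ≤ ‖diagonal c v‖ := Complex.re_le_norm _
  · have hδ1 : 0 ≤ δ := by nlinarith
    exact sq_mul_gaussian_le_of_nonneg hδ1 hδ'
      (mul_sub_inv_sq_le_of_nonneg hc hδ1 (by linarith)) hq
  · have hδ1 : δ ≤ 0 := by nlinarith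
    exact sq_mul_gaussian_le_of_nonpos hδ1 hδ
      (mul_sub_inv_sq_le_one_of_nonpos hc hδ1 (by linarith) (by linarith)) hq

theorem rpow_neg_le_mul_one_sub_add {τ x : ℝ} (hτ : 0 ≤ τ) (hτ1 : τ ≤ 1) (ha : 0 < a)
    (hx : 0 < x) : x ^ (-τ) ≤ a ^ (-τ) * ((1 - τ) + τ * (a / x)) := by
  have hamgm : (a / x) ^ τ ≤ (1 - τ) + τ * (a / x) := by
    simpa only [Real.one_rpow, one_mul, mul_one] using Real.geom_mean_le_arith_mean2_weighted
      (sub_nonneg.2 hτ1) hτ zero_le_one (div_nonneg ha.le hx.le) (sub_add_cancel _ _)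
  calc x ^ (-τ) = a ^ (-τ) * (a / x) ^ τ := by
        rw [Real.div_rpow ha.le hx.le, Real.rpow_neg ha.le, Real.rpow_neg hx.le]
        field_simp
    _ ≤ a ^ (-τ) * ((1 - τ) + τ * (a / x)) := by gcongr

theorem integral_rpow_mul_saddleDensity_le {τ : ℝ} (hτ : 0 ≤ τ) (hτ1 : τ ≤ 1)
    (hc : 3 / 2 ≤ c) (hcm : c = m + 1 / 2) (hac : |a - c| ≤ 1 / 2) (hca : 4 / 5 * c ≤ a) :
    ∫ v, ‖diagonal c v‖ ^ (-τ) * saddleDensity a c v ≤ a ^ (-τ) * √2 := by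
  have ha : 0 < a := by linarith
  have hint₀ := (integrable_saddleDensity (a := a) hcm).const_mul (1 - τ)
  have hint₁ := (integrable_div_norm_mul_saddleDensity (a := a) hcm).const_mul τ
  calc ∫ v, ‖diagonal c v‖ ^ (-τ) * saddleDensity a c v
      ≤ ∫ v, a ^ (-τ) * ((1 - τ) * saddleDensity a c v +
          τ * (a / ‖diagonal c v‖ * saddleDensity a c v)) :=
        integral_mono_of_nonneg
          (Eventually.of_forall fun v =>
            mul_nonneg (by positivity) (saddleDensity_nonneg a c v))
          ((hint₀.add hint₁).const_mul _) (Eventually.of_forall fun v =>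
            (mul_le_mul_of_nonneg_right (rpow_neg_le_mul_one_sub_add hτ hτ1 ha
              (norm_pos_iff.2 (diagonal_ne_zero (by linarith) v)))
              (saddleDensity_nonneg a c v)).trans_eq (by ring))
    _ = a ^ (-τ) * ((1 - τ) * (∫ v, saddleDensity a c v) +
        τ * ∫ v, a / ‖diagonal c v‖ * saddleDensity a c v) := by
        rw [integral_const_mul, integral_add hint₀ hint₁, integral_const_mul, integral_const_mul]
    _ ≤ a ^ (-τ) * ((1 - τ) * √2 + τ * √2) := by
        have := sub_nonneg.2 hτ1
        gcongr
        · exact integral_saddleDensity_le_sqrt_two hc hcm hac hca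
        · exact integral_div_norm_mul_saddleDensity_le_sqrt_two hc hcm hac hca
    _ = a ^ (-τ) * √2 := by ring

theorem one_le_norm_diagonal (hc : 3 / 2 ≤ c) (v : ℝ) : 1 ≤ ‖diagonal c v‖ := by
  refine le_trans ?_ (div_sqrt_two_le_norm_diagonal c v)
  rw [one_le_div (by positivity)]
  exact (Real.sqrt_le_iff.2 ⟨by norm_num, by norm_num⟩ : √2 ≤ 3 / 2).trans hc

theorem norm_one_add_I : ‖1 + I‖ = √2 := by
  simp [Complex.norm_def, Complex.normSq_apply, one_add_one_eq_two]

theorem norm_diagonalIntegral_le {s : ℂ} (hs : 0 ≤ s.re) (ht : s.im = 2 * π * a ^ 2)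
    (hc : 3 / 2 ≤ c) (hcm : c = m + 1 / 2) (hac : |a - c| ≤ 1 / 2) (hca : 4 / 5 * c ≤ a) :
    ‖diagonalIntegral s c‖ ≤ a ^ (-min s.re 1) := by
  have hτ : 0 ≤ min s.re 1 := le_min hs zero_le_one
  have hint := integrable_rpow_mul_saddleDensity_add_half hτ a m
  rw [← hcm] at hint
  have hbound : ∀ v, ‖riemannAuxIntegrand s (diagonal c v) * (1 + I)‖ ≤
      √2 / 2 * (‖diagonal c v‖ ^ (-min s.re 1) * saddleDensity a c v) := fun v => by
    have hmono : ‖diagonal c v‖ ^ (-s.re) ≤ ‖diagonal c v‖ ^ (-min s.re 1) :=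
      Real.rpow_le_rpow_of_exponent_le (one_le_norm_diagonal hc v)
        (neg_le_neg (min_le_left _ _))
    rw [norm_mul, norm_one_add_I, norm_riemannAuxIntegrand_diagonal (by linarith) ht, mul_comm,
      ← mul_div_assoc, mul_div_right_comm]
    have := saddleDensity_nonneg a c v
    gcongr
  calc ‖diagonalIntegral s c‖
      ≤ ∫ v, √2 / 2 * (‖diagonal c v‖ ^ (-min s.re 1) * saddleDensity a c v) :=
        norm_integral_le_of_norm_le (hint.const_mul _) (Eventually.of_forall hbound)
    _ ≤ √2 / 2 * (a ^ (-min s.re 1) * √2) := by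
        rw [integral_const_mul]
        gcongr
        exact integral_rpow_mul_saddleDensity_le hτ (min_le_right _ _) hc hcm hac hca
    _ = a ^ (-min s.re 1) := by
        linear_combination a ^ (-min s.re 1) / 2 * Real.mul_self_sqrt (zero_le_two (α := ℝ))

end SaddleBound

theorem abs_sub_floor_add_half_le {a : ℝ} (ha : 0 ≤ a) : |a - (⌊a⌋₊ + 1 / 2)| ≤ 1 / 2 := by
  rw [abs_le]
  constructor <;> linarith [Nat.floor_le ha, Nat.lt_floor_add_one a]

theorem four_fifths_mul_floor_add_half_le {a : ℝ} (ha : 6 / 5 ≤ a) :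
    4 / 5 * (⌊a⌋₊ + 1 / 2 : ℝ) ≤ a := by
  rcases le_or_gt ⌊a⌋₊ 1 with h | h
  · have : (⌊a⌋₊ : ℝ) ≤ 1 := by exact_mod_cast h
    linarith
  · have : (2 : ℝ) ≤ ⌊a⌋₊ := by exact_mod_cast h
    linarith [Nat.floor_le (by linarith : 0 ≤ a)]

theorem mainTheorem1_general {s : ℂ} (hσ : 0 ≤ s.re) (ht : 3 * π ≤ s.im) :
    ‖riemannAux s - ∑ n ∈ Finset.Icc 1 ⌊√(s.im / (2 * π))⌋₊, 1 / (n : ℂ) ^ s‖ ≤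
      (s.im / (2 * π)) ^ (-min s.re 1 / 2) := by
  have hquot : 3 / 2 ≤ s.im / (2 * π) := by
    rw [le_div_iff₀ Real.two_pi_pos]
    linarith
  have hquot0 : 0 ≤ s.im / (2 * π) := by linarith
  have hpow : (s.im / (2 * π)) ^ (-min s.re 1 / 2) = √(s.im / (2 * π)) ^ (-min s.re 1) := by
    rw [Real.sqrt_eq_rpow, ← Real.rpow_mul hquot0]
    ring_nf
  have him : s.im = 2 * π * √(s.im / (2 * π)) ^ 2 := by
    rw [Real.sq_sqrt hquot0]
    field_simp
  have hlarge : 6 / 5 ≤ √(s.im / (2 * π)) := Real.le_sqrt_of_sq_le (by linarith)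
  have hfloor : (1 : ℝ) ≤ ⌊√(s.im / (2 * π))⌋₊ := by
    exact_mod_cast Nat.le_floor (by push_cast; linarith)
  rw [riemannAux_sub_sum hσ, norm_neg, hpow]
  exact norm_diagonalIntegral_le hσ him (by linarith) rfl
    (abs_sub_floor_add_half_le (Real.sqrt_nonneg _)) (four_fifths_mul_floor_add_half_le hlarge)

theorem mainTheorem1 :
    (∀ σ t : ℝ, 0 ≤ σ → σ ≤ 1 → 3 * Real.pi ≤ t →
      ‖riemannAux (σ + t * Complex.I) -
          ∑ n ∈ Finset.Icc 1 ⌊Real.sqrt (t / (2 * Real.pi))⌋₊,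
            1 / (n : ℂ) ^ ((σ : ℂ) + t * Complex.I)‖
        ≤ (t / (2 * Real.pi)) ^ (-σ / 2)) ∧
    (∀ σ t : ℝ, 1 ≤ σ → 16 * Real.pi ≤ t →
      ‖riemannAux (σ + t * Complex.I) -
          ∑ n ∈ Finset.Icc 1 ⌊Real.sqrt (t / (2 * Real.pi))⌋₊,
            1 / (n : ℂ) ^ ((σ : ℂ) + t * Complex.I)‖
        ≤ (t / (2 * Real.pi)) ^ (-1 / 2 : ℝ)) := by
  refine ⟨fun σ t hσ0 hσ1 ht => ?_, fun σ t hσ ht => ?_⟩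
  · simpa [min_eq_left hσ1] using mainTheorem1_general (s := σ + t * I) (by simpa) (by simpa)
  · simpa [min_eq_right hσ] using mainTheorem1_general (s := σ + t * I)
      (by simpa using zero_le_one.trans hσ) (by simpa using by linarith [Real.pi_pos])
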